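/- **Proposition (Radon injectivity for manifolds).** A *geodesic* in a metric space is a globally minimizing curve parameterized with constant speed; a *complete geodesic* is a nonconstant geodesic defined on all of $\mathbb{R}$. Let $X$ be a Hadamard smooth manifold, that is, a smooth finite-dimensional Riemannian manifold without boundary which, with its Riemannian distance $d$, is complete, locally compact and $\mathrm{CAT}(0)$: any two points are joined by a geodesic, and for every $z\in X$, every geodesic $\gamma:[0,1]\to X$ and every $t\in[0,1]$, $$d^2(z,\gamma_t)\leqslant(1-t)\,d^2(z,\gamma_0)+t\,d^2(z,\gamma_1)-t(1-t)\,d^2(\gamma_0,\gamma_1).$$ (Negatively curved Hadamard manifolds are a particular case.) Let $\mathscr{W}_2(X)$ be the set of Borel probability measures $\mu$ on $X$ with $\int_X d^2(x_0,x)\,\mu(dx)<+\infty$ for some point $x_0\in X$. For a complete geodesic $\gamma$ of $X$ let $p_\gamma:X\to X$ send $y$ to the unique point of $\gamma$ closest to $y$, and let the perpendicular Radon transform $\mathscr{R}\mu$ of $\mu\in\mathscr{W}_2(X)$ be the map $\gamma\mapsto\mathscr{R}\mu(\gamma)=(p_\gamma)_\#\mu$ defined over all complete geodesics $\gamma$ of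 $X$. Then for every $\mu\in\mathscr{W}_2(X)$ and every finitely supported $\nu\in\mathscr{W}_2(X)$, if $\mathscr{R}\mu=\mathscr{R}\nu$ then $\mu=\nu$. -/

import Mathlib

open Set MeasureTheory Bundle
open scoped Manifold ContDiff

namespace PerpRadon

noncomputable section

/-- `γ`, restricted to `S ⊆ ℝ`, is a geodesic: globally minimizing, parameterized with constant
(possibly zero) speed. -/
def IsGeodesicOn {X : Type*} [MetricSpace X] (γ : ℝ → X) (S : Set ℝ) : Prop :=
  ∃ v : ℝ, 0 ≤ v ∧ ∀ s ∈ S, ∀ t ∈ S, dist (γ s) (γ t) = v * |s - t|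

/-- Nonpositive curvature in the sense of Alexandrov: `X` is a geodesic space, and the distance
from a vertex `z` of a geodesic triangle to a point of the opposite side is at most the
corresponding distance in the Euclidean comparison triangle (the right-hand side is the square of
that Euclidean distance). -/
structure IsCAT0 (X : Type*) [MetricSpace X] : Prop where
  exists_geodesic : ∀ x y : X, ∃ γ : ℝ → X, IsGeodesicOn γ (Icc 0 1) ∧ γ 0 = x ∧ γ 1 = y
  dist_sq_le : ∀ (z : X) (γ : ℝ → X), IsGeodesicOn γ (Icc 0 1) → ∀ t ∈ Icc (0 : ℝ) 1,
    dist z (γ t) ^ 2 ≤ (1 - t) * dist z (γ 0) ^ 2 + t * dist z (γ 1) ^ 2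
      - t * (1 - t) * dist (γ 0) (γ 1) ^ 2

/-- A Hadamard space: `CAT(0)`, complete and locally compact. -/
structure IsHadamard (X : Type*) [MetricSpace X] : Prop extends IsCAT0 X where
  complete : CompleteSpace X
  locallyCompact : LocallyCompactSpace X

/-- Complete geodesics: nonconstant minimizing geodesics of constant speed defined on all
of `ℝ`. -/
structure CompleteGeodesic (X : Type*) [MetricSpace X] where
  toFun : ℝ → X
  isGeodesic : ∃ v : ℝ, 0 < v ∧ ∀ s t : ℝ, dist (toFun s) (toFun t) = v * |s - t|

/-- `p` is a point of the geodesic `γ` that is closest to `y`. -/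
def IsClosest {X : Type*} [MetricSpace X] (γ : CompleteGeodesic X) (y p : X) : Prop :=
  p ∈ range γ.toFun ∧ ∀ q ∈ range γ.toFun, dist y p ≤ dist y q

/-- In a `CAT(0)` space the closest point exists and is unique. -/
theorem existsUnique_isClosest {X : Type*} [MetricSpace X] (hX : IsCAT0 X)
    (γ : CompleteGeodesic X) (y : X) : ∃! p, IsClosest γ y p := by
  obtain ⟨g, v, hv, hg⟩ := γ
  have hcont : Continuous g := by
    refine (LipschitzWith.of_dist_le_mul (K := ⟨v, hv.le⟩) fun s t => ?_).continuous
    rw [hg, Real.dist_eq]; rfl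
  have htend : Filter.Tendsto (fun t => dist y (g t)) (Filter.cocompact ℝ) Filter.atTop := by
    have h1 : Filter.Tendsto (fun t : ℝ => v * |t| - dist y (g 0)) (Filter.cocompact ℝ)
        Filter.atTop :=
      Filter.tendsto_atTop_add_const_right _ _
        ((tendsto_norm_cocompact_atTop (E := ℝ)).const_mul_atTop hv)
    refine Filter.tendsto_atTop_mono (fun t => ?_) h1
    have h2 := hg 0 t
    have h3 := dist_triangle_left (g 0) (g t) y
    rw [zero_sub, abs_neg] at h2
    linarith
  obtain ⟨t₀, ht₀⟩ := (continuous_const.dist hcont).exists_forall_le htend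
  refine ⟨g t₀, ⟨⟨t₀, rfl⟩, ?_⟩, ?_⟩
  · rintro _ ⟨t, rfl⟩
    exact ht₀ t
  · rintro _ ⟨⟨t₁, rfl⟩, h⟩
    have e : dist y (g t₁) = dist y (g t₀) := le_antisymm (h _ ⟨t₀, rfl⟩) (ht₀ t₁)
    have hc := hX.dist_sq_le y (fun r => g (t₀ + r * (t₁ - t₀)))
      ⟨v * |t₁ - t₀|, by positivity, fun s _ t _ => by
        rw [hg, mul_assoc, ← abs_mul]; congr 2; ring⟩ (1 / 2) (by norm_num)
    have hm := ht₀ (t₀ + 1 / 2 * (t₁ - t₀))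
    have hm2 : dist y (g t₀) ^ 2 ≤ dist y (g (t₀ + 1 / 2 * (t₁ - t₀))) ^ 2 :=
      pow_le_pow_left₀ dist_nonneg hm 2
    simp only [zero_mul, add_zero, one_mul, add_sub_cancel] at hc
    rw [e] at hc
    have : dist (g t₀) (g t₁) = 0 := by
      have := sq_nonneg (dist (g t₀) (g t₁))
      exact pow_eq_zero_iff (two_ne_zero) |>.1 (by linarith)
    exact (dist_eq_zero.1 this).symm

/-- The projection `p_γ` to a complete geodesic: the point of `γ` closest to `y` (an arbitrary
value if there is none, which does not happen in a `CAT(0)` space). -/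
def proj {X : Type*} [MetricSpace X] (γ : CompleteGeodesic X) (y : X) : X :=
  @Classical.epsilon X ⟨y⟩ (IsClosest γ y)

theorem proj_spec {X : Type*} [MetricSpace X] (hX : IsCAT0 X) (γ : CompleteGeodesic X) (y : X) :
    IsClosest γ y (proj γ y) :=
  Classical.epsilon_spec (existsUnique_isClosest hX γ y).exists

/-- In a `CAT(0)` space, `p_γ` is continuous, hence Borel, so that push-forwards by `p_γ` are
meaningful. -/
theorem continuous_proj {X : Type*} [MetricSpace X] (hX : IsCAT0 X) (γ : CompleteGeodesic X) :
    Continuous (proj γ) := by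
  -- if `p` is the projection of `y`, then `d(p,q)² + d(y,p)² ≤ d(y,q)²` for `q` on `γ`
  have key : ∀ y, ∀ q ∈ range γ.toFun,
      dist (proj γ y) q ^ 2 + dist y (proj γ y) ^ 2 ≤ dist y q ^ 2 := by
    rintro y _ ⟨t₁, rfl⟩
    obtain ⟨⟨t₀, h0⟩, hmin⟩ := proj_spec hX γ y
    rw [← h0] at hmin ⊢
    obtain ⟨g, v, hv, hg⟩ := γ
    change dist (g t₀) (g t₁) ^ 2 + dist y (g t₀) ^ 2 ≤ dist y (g t₁) ^ 2
    have hc : ∀ r ∈ Ioc (0 : ℝ) 1,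
        (1 - r) * dist (g t₀) (g t₁) ^ 2 ≤ dist y (g t₁) ^ 2 - dist y (g t₀) ^ 2 := by
      intro r hr
      have hc := hX.dist_sq_le y (fun r => g (t₀ + r * (t₁ - t₀)))
        ⟨v * |t₁ - t₀|, by positivity, fun s _ t _ => by
          rw [hg, mul_assoc, ← abs_mul]; congr 2; ring⟩ r ⟨hr.1.le, hr.2⟩
      simp only [zero_mul, add_zero, one_mul, add_sub_cancel] at hc
      have hm2 : dist y (g t₀) ^ 2 ≤ dist y (g (t₀ + r * (t₁ - t₀))) ^ 2 :=
        pow_le_pow_left₀ dist_nonneg (hmin _ ⟨_, rfl⟩) 2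
      have h3 := hr.1
      refine le_of_mul_le_mul_left ?_ h3
      nlinarith
    have hl : Filter.Tendsto (fun r : ℝ => (1 - r) * dist (g t₀) (g t₁) ^ 2)
        (nhdsWithin 0 (Ioi 0)) (nhds ((1 - 0) * dist (g t₀) (g t₁) ^ 2)) :=
      (Continuous.tendsto (by fun_prop) 0).mono_left nhdsWithin_le_nhds
    have := le_of_tendsto hl (Filter.eventually_of_mem
      (Ioc_mem_nhdsGT (show (0 : ℝ) < 1 by norm_num)) hc)
    linarith
  rw [continuous_iff_continuousAt]
  intro y
  rw [ContinuousAt, tendsto_iff_dist_tendsto_zero]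
  have hb : ∀ z, dist (proj γ z) (proj γ y) ^ 2 ≤
      (2 * dist z y) * (2 * dist z y + 2 * dist y (proj γ y)) := by
    intro z
    have h1 := key y _ (proj_spec hX γ z).1
    have h2 := (proj_spec hX γ z).2 _ (proj_spec hX γ y).1
    have h3 := dist_triangle y z (proj γ z)
    have h4 := dist_triangle z y (proj γ y)
    rw [dist_comm (proj γ y), dist_comm y z] at *
    have h5 : dist y (proj γ z) ≤ 2 * dist z y + dist y (proj γ y) := by linarith
    have h6 : dist y (proj γ z) ^ 2 ≤ (2 * dist z y + dist y (proj γ y)) ^ 2 :=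
      pow_le_pow_left₀ dist_nonneg h5 2
    nlinarith
  have hlim : Filter.Tendsto
      (fun z => (2 * dist z y) * (2 * dist z y + 2 * dist y (proj γ y))) (nhds y) (nhds 0) := by
    have : Continuous
        (fun z => (2 * dist z y) * (2 * dist z y + 2 * dist y (proj γ y))) := by fun_prop
    simpa using this.tendsto y
  have hsq := squeeze_zero (fun z => sq_nonneg (dist (proj γ z) (proj γ y))) hb hlim
  simpa [Function.comp_def, Real.sqrt_sq dist_nonneg] using
    (Real.continuous_sqrt.tendsto 0).comp hsq

/-- The elements of the quadratic Wasserstein space `𝒲₂(X)`: Borel probability measures with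
finite second moment. -/
structure W₂ (X : Type*) [MetricSpace X] [MeasurableSpace X] where
  toMeasure : Measure X
  isProbability : IsProbabilityMeasure toMeasure
  finite_moment : ∃ x₀ : X, ∫⁻ x, edist x₀ x ^ 2 ∂toMeasure < ⊤

/-- The perpendicular Radon transform `γ ↦ (p_γ)_# μ`, defined over the complete geodesics
of `X`. -/
def radon {X : Type*} [MetricSpace X] [MeasurableSpace X] (μ : W₂ X) :
    CompleteGeodesic X → Measure X :=
  fun γ => μ.toMeasure.map (proj γ)

/-- `ν` is finitely supported. -/
def IsFinitelySupported {X : Type*} [MetricSpace X] [MeasurableSpace X] (ν : W₂ X) : Prop :=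
  ∃ S : Set X, S.Finite ∧ ν.toMeasure Sᶜ = 0

end

end PerpRadon

namespace PerpRadon

open Filter Manifold
open scoped Topology ENNReal

/-! The transform determines the mass of every atom, and a probability measure with the same atoms
as a finitely supported one equals it. To recover `μ {x}` it is enough to have complete geodesics `γ
k` through `x` such that each `y ≠ x` satisfies `proj (γ k) y ≠ x` for all large `k`: the indicators
of the fibers over `x` then converge pointwise to that of `{x}`, so the masses given to `x` by the
transform along `γ k` tend to `μ {x}` (`tendsto_radon_singleton`). By first variation, a point
projecting to `x` is seen from `x` orthogonally to the geodesic (`HasDir.inner_eq_zero`). So the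
directions of the `γ k` need only be such that no nonzero vector is orthogonal to infinitely many of
them; points of a moment curve have this property (`exists_unit_sequence`).

It remains to produce enough complete geodesics through `x`. No exponential map is used: the
Riemannian structure enters only through charts that are almost isometric near `x`
(`exists_infinitesimalChart`), and tangent vectors are first-order limits along an ultrafilter.
Convexity of the distance to `y` and infinitesimal flatness make this distance grow at a rate close
to `1` in some direction (`exists_slope`); an Ekeland-type argument turns this into extension of
geodesics (`exists_line`). Finally, send a unit vector `v` to the limit of the directions of the
geodesics from `x` to the points of coordinate `t • v`. This map is 1-Lipschitz by comparison and
odd by extension, hence preserves inner products, and its values are directions of complete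
geodesics (`exists_directions`). It need not be identified with the identity in order to transport
the moment curve. -/

theorem enorm_le_mul_enorm {V W : Type*} [SeminormedAddCommGroup V] [SeminormedAddCommGroup W]
    {v : V} {w : W} {C : NNReal} (h : ‖v‖ ≤ C * ‖w‖) : ‖v‖ₑ ≤ C * ‖w‖ₑ := by
  rw [enorm_eq_nnnorm, enorm_eq_nnnorm]
  exact_mod_cast h

/-! ### Riemannian charts are almost isometric near their center -/

section Bundle
variable {B : Type*} [TopologicalSpace B]
  (F : Type*) [NormedAddCommGroup F] [NormedSpace ℝ F]
  (V : B → Type*) [TopologicalSpace (TotalSpace F V)] [∀ x, NormedAddCommGroup (V x)]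
  [∀ x, InnerProductSpace ℝ (V x)] [FiberBundle F V] [VectorBundle ℝ F V]

/-- The preferred trivialization at `x`, on the fiber over `x`. -/
noncomputable def fiberCoord (x : B) : V x ≃L[ℝ] F :=
  (trivializationAt F V x).continuousLinearEquivAt ℝ x (FiberBundle.mem_baseSet_trivializationAt' x)

variable [IsContinuousRiemannianBundle F V]

theorem eventually_norm_fiberCoord_symm_le (x : B) {C : ℝ} (hC : 1 < C) :
    ∀ᶠ y in 𝓝 x, ∀ v : V y,
      ‖(fiberCoord F V x).symm ((trivializationAt F V x).continuousLinearMapAt ℝ y v)‖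
        ≤ C * ‖v‖ := by
  filter_upwards [eventually_norm_symmL_trivializationAt_self_comp_lt F V x hC] with y hy v
  have h := ContinuousLinearMap.le_of_opNorm_le _ hy.le v
  rw [ContinuousLinearMap.comp_apply, Trivialization.symmL_apply _
    (FiberBundle.mem_baseSet_trivializationAt' x)] at h
  exact h

theorem eventually_norm_symmL_fiberCoord_le (x : B) {C : ℝ} (hC : 1 < C) :
    ∀ᶠ y in 𝓝 x, ∀ v : V x,
      ‖(trivializationAt F V x).symmL ℝ y (fiberCoord F V x v)‖ ≤ C * ‖v‖ := by
  filter_upwards [eventually_norm_symmL_trivializationAt_comp_self_lt F V x hC] with y hy v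
  have h := ContinuousLinearMap.le_of_opNorm_le _ hy.le v
  rw [ContinuousLinearMap.comp_apply, Trivialization.continuousLinearMapAt_apply,
    Trivialization.linearMapAt_apply, if_pos (FiberBundle.mem_baseSet_trivializationAt' x)] at h
  exact h

end Bundle

section Riem
variable {E : Type*} [NormedAddCommGroup E] [NormedSpace ℝ E] {M : Type*} [MetricSpace M]
  [ChartedSpace E M] [IsManifold 𝓘(ℝ, E) 1 M]
  [RiemannianBundle (fun x : M => TangentSpace 𝓘(ℝ, E) x)]
  [IsContinuousRiemannianBundle E (fun x : M => TangentSpace 𝓘(ℝ, E) x)]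
  [IsRiemannianManifold 𝓘(ℝ, E) M]

variable (E) in
/-- The tangent space at `x`, identified with the model space through the chart at `x`. -/
noncomputable def tangentCoord (x : M) : TangentSpace 𝓘(ℝ, E) x ≃L[ℝ] E :=
  fiberCoord E (fun x : M => TangentSpace 𝓘(ℝ, E) x) x

/-- Near `x`, the distance is at most `C` times the distance read in the chart at `x` and measured
with the metric at `x`, for any `C > 1`. -/
theorem exists_edist_le_enorm_coord_sub (x : M) {C : NNReal} (hC : 1 < C) :
    ∃ u ∈ 𝓝 x, ∀ p ∈ u, ∀ q ∈ u, edist p q ≤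
      C * ‖(tangentCoord E x).symm (extChartAt 𝓘(ℝ, E) x q - extChartAt 𝓘(ℝ, E) x p)‖ₑ := by
  have hC' : (1 : ℝ) < C := by exact_mod_cast hC
  set e := extChartAt 𝓘(ℝ, E) x with he
  obtain ⟨r, r_pos, hr⟩ : ∃ r > 0, Metric.ball (e x) r ⊆ e.target ∩
      {z | ∀ v : TangentSpace 𝓘(ℝ, E) x,
      ‖(trivializationAt E (fun x : M => TangentSpace 𝓘(ℝ, E) x) x).symmL ℝ (e.symm z)
        (tangentCoord E x v)‖ ≤ C * ‖v‖} := by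
    refine Metric.mem_nhds_iff.1 (inter_mem (extChartAt_target_mem_nhds x) ?_)
    have : Tendsto e.symm (𝓝 (e x)) (𝓝 x) := by
      have := continuousAt_extChartAt_symm (I := 𝓘(ℝ, E)) x
      rwa [ContinuousAt, extChartAt_to_inv] at this
    exact this.eventually (eventually_norm_symmL_fiberCoord_le E _ x hC')
  refine ⟨e ⁻¹' Metric.ball (e x) r ∩ e.source, inter_mem
    ((continuousAt_extChartAt x).preimage_mem_nhds (Metric.ball_mem_nhds _ r_pos))
    (extChartAt_source_mem_nhds x), ?_⟩
  rintro p ⟨hp, hps⟩ q ⟨hq, hqs⟩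
  -- The segment in the chart is a competitor for the distance; its speed is at most `C` times the
  -- constant speed measured with the metric at `x`.
  let η : ℝ → E := fun t => e p + t • (e q - e p)
  have hη : ∀ t ∈ Icc (0 : ℝ) 1, η t ∈ Metric.ball (e x) r := by
    intro t ht
    apply (convex_ball (e x) r).segment_subset hp hq
    rw [segment_eq_image']
    exact ⟨t, ht, rfl⟩
  have η_smooth : ContMDiff 𝓘(ℝ, ℝ) 𝓘(ℝ, E) 1 η := by
    rw [contMDiff_iff_contDiff]
    fun_prop
  rw [IsRiemannianManifold.out (I := 𝓘(ℝ, E)) p q]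
  have h1 : riemannianEDist 𝓘(ℝ, E) p q ≤ pathELength 𝓘(ℝ, E) (e.symm ∘ η) 0 1 := by
    apply riemannianEDist_le_pathELength _ _ _ zero_le_one
    · exact (contMDiffOn_extChartAt_symm x).comp η_smooth.contMDiffOn fun t ht => (hr (hη t ht)).1
    · simp [η, e.left_inv hps]
    · simp [η, e.left_inv hqs]
  refine h1.trans ?_
  rw [pathELength_eq_lintegral_mfderivWithin_Icc]
  have h2 : ∀ t ∈ Icc (0 : ℝ) 1, ‖mfderivWithin 𝓘(ℝ, ℝ) 𝓘(ℝ, E) (e.symm ∘ η) (Icc 0 1) t 1‖ₑ ≤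
      C * ‖(tangentCoord E x).symm (e q - e p)‖ₑ := by
    intro t ht
    set y := e.symm (η t) with hy
    have hyt : e y = η t := e.right_inv (hr (hη t ht)).1
    have hys : y ∈ (chartAt E x).source := by
      rw [← extChartAt_source 𝓘(ℝ, E)]
      exact e.map_target (hr (hη t ht)).1
    have hs : ∀ z : E, e y = z → ∀ w : E,
        (mfderivWithin 𝓘(ℝ, E) 𝓘(ℝ, E) e.symm (range 𝓘(ℝ, E)) z w : E) =
        ((trivializationAt E (fun x : M => TangentSpace 𝓘(ℝ, E) x) x).symmL ℝ y w : E) := by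
      rintro _ rfl w
      rw [TangentBundle.symmL_trivializationAt hys]
      rfl
    have hc : mfderivWithin 𝓘(ℝ, ℝ) 𝓘(ℝ, E) (e.symm ∘ η) (Icc 0 1) t =
        (mfderivWithin 𝓘(ℝ, E) 𝓘(ℝ, E) e.symm (range 𝓘(ℝ, E)) (η t)) ∘L
          (mfderivWithin 𝓘(ℝ, ℝ) 𝓘(ℝ, E) η (Icc 0 1) t) := by
      apply mfderivWithin_comp
      · exact mdifferentiableWithinAt_extChartAt_symm (hr (hη t ht)).1
      · exact η_smooth.contMDiffOn.mdifferentiableOn one_ne_zero t ht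
      · exact fun _ _ => by simp
      · rw [uniqueMDiffWithinAt_iff_uniqueDiffWithinAt]
        exact uniqueDiffOn_Icc zero_lt_one t ht
    have hd : (mfderivWithin 𝓘(ℝ, ℝ) 𝓘(ℝ, E) η (Icc 0 1) t (1 : ℝ) : E) = e q - e p := by
      have h : HasFDerivAt η ((1 : ℝ →L[ℝ] ℝ).smulRight (e q - e p)) t :=
        ((hasFDerivAt_id t).smul_const (e q - e p)).const_add (e p)
      rw [mfderivWithin_eq_fderivWithin,
        h.hasFDerivWithinAt.fderivWithin (uniqueDiffOn_Icc zero_lt_one t ht)]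
      exact one_smul ℝ _
    have hv : (mfderivWithin 𝓘(ℝ, ℝ) 𝓘(ℝ, E) (e.symm ∘ η) (Icc 0 1) t (1 : ℝ) : E) =
        ((trivializationAt E (fun x : M => TangentSpace 𝓘(ℝ, E) x) x).symmL ℝ y
          (tangentCoord E x ((tangentCoord E x).symm (e q - e p))) : E) := by
      rw [ContinuousLinearEquiv.apply_symm_apply, ← hs _ hyt, ← hd, hc]
      rfl
    have hn := (hr (hη t ht)).2 ((tangentCoord E x).symm (e q - e p))
    refine enorm_le_mul_enorm (le_trans (le_of_eq ?_) hn)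
    exact congrArg (fun w : TangentSpace 𝓘(ℝ, E) y => ‖w‖) hv
  calc _ ≤ ∫⁻ t in Icc (0 : ℝ) 1, C * ‖(tangentCoord E x).symm (e q - e p)‖ₑ :=
        setLIntegral_mono' measurableSet_Icc h2
    _ = _ := by simp

/-- Near `x`, the distance read in the chart at `x` and measured with the metric at `x` is at most
`C` times the distance, for any `C > 1`. -/
theorem exists_enorm_coord_sub_le (x : M) {C : NNReal} (hC : 1 < C) :
    ∃ u ∈ 𝓝 x, ∀ p ∈ u, ∀ q ∈ u,
      ‖(tangentCoord E x).symm (extChartAt 𝓘(ℝ, E) x q - extChartAt 𝓘(ℝ, E) x p)‖ₑ ≤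
        C * edist p q := by
  have hC' : (1 : ℝ) < C := by exact_mod_cast hC
  set e := extChartAt 𝓘(ℝ, E) x with he
  obtain ⟨r, r_pos, hr⟩ := Metric.eventually_nhds_iff_ball.1
    ((eventually_norm_fiberCoord_symm_le E (fun x : M => TangentSpace 𝓘(ℝ, E) x) x hC').and
      (chart_source_mem_nhds E x))
  -- A curve from `p` to `q` of length below `dist p q + η`, with `η < r / 4`, stays within `r / 2 +
  -- r / 4 + r / 4 = r` of `x`. The slack `η` is needed because the infimum of lengths may not be
  -- attained; it tends to `0` at the end.
  refine ⟨Metric.ball x (r / 4), Metric.ball_mem_nhds _ (by positivity), fun p hp q hq => ?_⟩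
  suffices H : ∀ η : NNReal, 0 < η → η < r / 4 →
      ‖(tangentCoord E x).symm (e q - e p)‖ₑ ≤ C * (edist p q + η) by
    have hl : Tendsto (fun η : NNReal => (C : ENNReal) * (edist p q + η)) (𝓝[>] 0)
        (𝓝 (C * (edist p q + (0 : NNReal)))) := by
      refine Tendsto.mono_left ?_ nhdsWithin_le_nhds
      exact ENNReal.Tendsto.const_mul (tendsto_const_nhds.add
        (ENNReal.continuous_coe.tendsto 0)) (Or.inr ENNReal.coe_ne_top)
    rw [ENNReal.coe_zero, add_zero] at hl
    refine ge_of_tendsto hl ?_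
    filter_upwards [Ioo_mem_nhdsGT (show (0 : NNReal) < ⟨r / 4, by positivity⟩ from
      NNReal.coe_lt_coe.1 (show (0 : ℝ) < r / 4 by positivity))] with η hη
    exact H η hη.1 (NNReal.coe_lt_coe.2 hη.2)
  intro η hη hηr
  have hpq : riemannianEDist 𝓘(ℝ, E) p q < edist p q + η := by
    rw [← IsRiemannianManifold.out (I := 𝓘(ℝ, E)) p q]
    exact ENNReal.lt_add_right (edist_ne_top _ _) (by exact_mod_cast hη.ne')
  obtain ⟨γ, hγ0, hγ1, hγ, hlen⟩ := exists_lt_of_riemannianEDist_lt hpq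
  have hball : ∀ t ∈ Icc (0 : ℝ) 1, γ t ∈ Metric.ball x r := by
    intro t ht
    have h1 : edist p (γ t) < edist p q + η := by
      rw [IsRiemannianManifold.out (I := 𝓘(ℝ, E)) p (γ t)]
      refine lt_of_le_of_lt (riemannianEDist_le_pathELength (hγ.mono (Icc_subset_Icc_right ht.2))
        hγ0 rfl ht.1) (lt_of_le_of_lt (pathELength_mono le_rfl ht.2) hlen)
    have hη' : (η : ENNReal) = ENNReal.ofReal η := (ENNReal.ofReal_coe_nnreal).symm
    have hη0 : (0 : ℝ) < η := hη
    rw [edist_dist, edist_dist, hη', ← ENNReal.ofReal_add dist_nonneg hη0.le,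
      ENNReal.ofReal_lt_ofReal_iff (by positivity)] at h1
    have h2 := dist_triangle_right p q x
    have h3 := dist_triangle (γ t) p x
    rw [dist_comm (γ t) p] at h3
    rw [Metric.mem_ball] at *
    linarith
  have hsm0 : ContDiffOn ℝ 1 (e ∘ γ) (Icc 0 1) := by
    rw [← contMDiffOn_iff_contDiffOn]
    exact contMDiffOn_extChartAt.comp hγ fun t ht => (hr _ (hball t ht)).2
  have hsm : ContDiffOn ℝ 1 (fun t => (tangentCoord E x).symm (e (γ t))) (Icc 0 1) :=
    (tangentCoord E x).symm.contDiff.comp_contDiffOn hsm0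
  have h1 := enorm_sub_le_lintegral_derivWithin_Icc_of_contDiffOn_Icc hsm zero_le_one
  rw [hγ0, hγ1, ← map_sub] at h1
  refine h1.trans (le_trans ?_ (mul_le_mul_right hlen.le _))
  rw [pathELength_eq_lintegral_mfderivWithin_Icc, ← lintegral_const_mul' _ _ ENNReal.coe_ne_top]
  refine setLIntegral_mono' measurableSet_Icc fun t ht => ?_
  have hs := (hr _ (hball t ht)).2
  have hc : mfderivWithin 𝓘(ℝ, ℝ) 𝓘(ℝ, E) (e ∘ γ) (Icc 0 1) t =
      (mfderiv 𝓘(ℝ, E) 𝓘(ℝ, E) e (γ t)) ∘L (mfderivWithin 𝓘(ℝ, ℝ) 𝓘(ℝ, E) γ (Icc 0 1) t) := by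
    apply mfderiv_comp_mfderivWithin
    · exact mdifferentiableAt_extChartAt hs
    · exact hγ.mdifferentiableOn one_ne_zero _ ht
    · rw [uniqueMDiffWithinAt_iff_uniqueDiffWithinAt]
      exact uniqueDiffOn_Icc zero_lt_one _ ht
  have hd : derivWithin (e ∘ γ) (Icc 0 1) t =
      (trivializationAt E (fun x : M => TangentSpace 𝓘(ℝ, E) x) x).continuousLinearMapAt ℝ (γ t)
        (mfderivWithin 𝓘(ℝ, ℝ) 𝓘(ℝ, E) γ (Icc 0 1) t (1 : ℝ)) := by
    rw [TangentBundle.continuousLinearMapAt_trivializationAt hs, ← fderivWithin_derivWithin,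
      ← mfderivWithin_eq_fderivWithin, hc]
    rfl
  have hd2 : derivWithin (fun t => (tangentCoord E x).symm (e (γ t))) (Icc 0 1) t =
      (tangentCoord E x).symm (derivWithin (e ∘ γ) (Icc 0 1) t) := by
    have h : HasDerivWithinAt (e ∘ γ) (derivWithin (e ∘ γ) (Icc 0 1) t) (Icc 0 1) t :=
      (hsm0.differentiableOn one_ne_zero t ht).hasDerivWithinAt
    exact (((tangentCoord E x).symm : E →L[ℝ] TangentSpace 𝓘(ℝ, E) x).hasFDerivAt.comp_hasDerivWithinAt
      t h).derivWithin (uniqueDiffOn_Icc zero_lt_one t ht)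
  rw [hd2, hd]
  exact enorm_le_mul_enorm ((hr _ (hball t ht)).1 _)

/-- A map from a neighborhood of `x` to a normed space which distorts distances by a factor
tending to `1` at `x`, and covers a neighborhood of the origin. -/
structure InfinitesimalChart {X : Type*} [MetricSpace X] (V : Type*) [NormedAddCommGroup V]
    (x : X) where
  toFun : X → V
  invFun : V → X
  map_base : toFun x = 0
  tendsto_invFun : Tendsto invFun (𝓝 0) (𝓝 x)
  right_inv : ∀ᶠ v in 𝓝 0, toFun (invFun v) = v
  dist_le : ∀ C : ℝ, 1 < C → ∃ u ∈ 𝓝 x, ∀ p ∈ u, ∀ q ∈ u, dist p q ≤ C * ‖toFun p - toFun q‖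
  norm_le : ∀ C : ℝ, 1 < C → ∃ u ∈ 𝓝 x, ∀ p ∈ u, ∀ q ∈ u, ‖toFun p - toFun q‖ ≤ C * dist p q

theorem nonempty_infinitesimalChart (x : M) :
    Nonempty (InfinitesimalChart (TangentSpace 𝓘(ℝ, E) x) x) := by
  let e := extChartAt 𝓘(ℝ, E) x
  have hinv : Tendsto (fun v => e x + tangentCoord E x v) (𝓝 0) (𝓝 (e x)) := by
    have : Continuous fun v => e x + tangentCoord E x v := by fun_prop
    simpa using this.tendsto 0
  refine ⟨⟨fun p => (tangentCoord E x).symm (e p - e x), fun v => e.symm (e x + tangentCoord E x v),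
    ?_, ?_, ?_, ?_, ?_⟩⟩
  · rw [sub_self, map_zero]
  · have h := continuousAt_extChartAt_symm (I := 𝓘(ℝ, E)) x
    rw [ContinuousAt, extChartAt_to_inv] at h
    exact h.comp hinv
  · filter_upwards [hinv.eventually (extChartAt_target_mem_nhds x)] with v hv
    rw [e.right_inv hv, add_sub_cancel_left, ContinuousLinearEquiv.symm_apply_apply]
  · intro C hC
    lift C to NNReal using by linarith
    obtain ⟨u, hu, h⟩ := exists_edist_le_enorm_coord_sub (E := E) x (C := C) (by exact_mod_cast hC)
    refine ⟨u, hu, fun p hp q hq => ?_⟩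
    have := h q hq p hp
    rw [← map_sub, sub_sub_sub_cancel_right]
    rw [edist_comm, edist_nndist, enorm_eq_nnnorm] at this
    exact_mod_cast this
  · intro C hC
    lift C to NNReal using by linarith
    obtain ⟨u, hu, h⟩ := exists_enorm_coord_sub_le (E := E) x (C := C) (by exact_mod_cast hC)
    refine ⟨u, hu, fun p hp q hq => ?_⟩
    have := h q hq p hp
    rw [← map_sub, sub_sub_sub_cancel_right]
    rw [edist_comm, edist_nndist, enorm_eq_nnnorm] at this
    exact_mod_cast this

end Riem

/-- The only place where the Riemannian structure reaches the rest of the proof; of the regularity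
of the metric, only continuity is used. -/
theorem exists_infinitesimalChart (n : ℕ) {X : Type*} [MetricSpace X]
    [ChartedSpace (EuclideanSpace ℝ (Fin n)) X] [IsManifold (𝓡 n) ∞ X]
    [RiemannianBundle (fun x : X => TangentSpace (𝓡 n) x)]
    [IsContMDiffRiemannianBundle (𝓡 n) ∞ (EuclideanSpace ℝ (Fin n))
      (fun x : X => TangentSpace (𝓡 n) x)]
    [IsRiemannianManifold (𝓡 n) X] (x : X) :
    ∃ (V : Type) (_ : NormedAddCommGroup V) (_ : InnerProductSpace ℝ V)
      (_ : FiniteDimensional ℝ V), Nonempty (InfinitesimalChart V x) := by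
  have hc : IsContMDiffRiemannianBundle (𝓡 n) 0 (EuclideanSpace ℝ (Fin n))
      (fun x : X => TangentSpace (𝓡 n) x) := .of_le (n := ∞) (by simp)
  have : IsContinuousRiemannianBundle (EuclideanSpace ℝ (Fin n))
      (fun x : X => TangentSpace (𝓡 n) x) := by
    obtain ⟨g, hg, h⟩ := hc.exists_contMDiff
    exact ⟨g, hg.continuous, h⟩
  exact ⟨TangentSpace (𝓡 n) x, inferInstance, inferInstance,
    (tangentCoord (EuclideanSpace ℝ (Fin n)) x).symm.toLinearEquiv.finiteDimensional,
    nonempty_infinitesimalChart x⟩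

/-! ### Geodesics in CAT(0) spaces: uniqueness, convexity, comparison -/

theorem div_mem_Icc_zero_one {D s : ℝ} (hs : s ∈ Icc 0 D) : s / D ∈ Icc (0 : ℝ) 1 :=
  ⟨div_nonneg hs.1 (hs.1.trans hs.2), div_le_one_of_le₀ hs.2 (hs.1.trans hs.2)⟩

section CAT0
variable {X : Type*} [MetricSpace X]

namespace IsCAT0

/-- A choice of a geodesic from `p` to `q`, parameterized by `[0, 1]`. -/
noncomputable def seg (hX : IsCAT0 X) (p q : X) : ℝ → X := (hX.exists_geodesic p q).choose

variable (hX : IsCAT0 X)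
include hX

theorem seg_zero (p q : X) : hX.seg p q 0 = p := (hX.exists_geodesic p q).choose_spec.2.1

theorem seg_one (p q : X) : hX.seg p q 1 = q := (hX.exists_geodesic p q).choose_spec.2.2

theorem isGeodesicOn_seg (p q : X) : IsGeodesicOn (hX.seg p q) (Icc 0 1) :=
  (hX.exists_geodesic p q).choose_spec.1

theorem dist_seg_seg (p q : X) {s t : ℝ} (hs : s ∈ Icc (0 : ℝ) 1) (ht : t ∈ Icc (0 : ℝ) 1) :
    dist (hX.seg p q s) (hX.seg p q t) = |s - t| * dist p q := by
  obtain ⟨v, -, h⟩ := hX.isGeodesicOn_seg p q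
  have h01 := h 0 (by simp) 1 (by simp)
  rw [hX.seg_zero, hX.seg_one] at h01
  rw [h s hs t ht, h01]
  norm_num [mul_comm]

theorem dist_left_seg (p q : X) {t : ℝ} (ht : t ∈ Icc (0 : ℝ) 1) :
    dist p (hX.seg p q t) = t * dist p q := by
  have := hX.dist_seg_seg p q (s := 0) (by simp) ht
  rwa [hX.seg_zero, zero_sub, abs_neg, abs_of_nonneg ht.1] at this

theorem dist_seg_right (p q : X) {t : ℝ} (ht : t ∈ Icc (0 : ℝ) 1) :
    dist (hX.seg p q t) q = (1 - t) * dist p q := by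
  have := hX.dist_seg_seg p q ht (t := 1) (by simp)
  rwa [hX.seg_one, abs_sub_comm, abs_of_nonneg (by linarith [ht.2])] at this

theorem dist_seg_sq_le (z p q : X) {t : ℝ} (ht : t ∈ Icc (0 : ℝ) 1) :
    dist z (hX.seg p q t) ^ 2 ≤ (1 - t) * dist z p ^ 2 + t * dist z q ^ 2
      - t * (1 - t) * dist p q ^ 2 := by
  have := hX.dist_sq_le z _ (hX.isGeodesicOn_seg p q) t ht
  rwa [hX.seg_zero, hX.seg_one] at this

/-- Uniqueness of geodesics: in the CAT(0) inequality with vertex `m` itself, the right-hand side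
vanishes. -/
theorem eq_seg {p q m : X} {t : ℝ} (ht : t ∈ Icc (0 : ℝ) 1) (h₁ : dist p m = t * dist p q)
    (h₂ : dist m q = (1 - t) * dist p q) : m = hX.seg p q t := by
  have h := hX.dist_seg_sq_le m p q ht
  rw [dist_comm m p, h₁, h₂] at h
  have : dist m (hX.seg p q t) ^ 2 ≤ 0 := h.trans (le_of_eq (by ring))
  exact dist_eq_zero.1 (pow_eq_zero_iff two_ne_zero |>.1 (le_antisymm this (sq_nonneg _)))

/-- Since `|dist z p - dist z q| ≤ dist p q`, the CAT(0) bound is at most the square of the affine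
interpolation. -/
theorem dist_seg_le (z p q : X) {t : ℝ} (ht : t ∈ Icc (0 : ℝ) 1) :
    dist z (hX.seg p q t) ≤ (1 - t) * dist z p + t * dist z q := by
  have h := hX.dist_seg_sq_le z p q ht
  have h1 := dist_triangle z p q
  have h2 := dist_triangle z q p
  rw [dist_comm q p] at h2
  have h3 : (dist z p - dist z q) ^ 2 ≤ dist p q ^ 2 :=
    sq_le_sq' (by linarith) (by linarith)
  have ht1 : 0 ≤ 1 - t := by linarith [ht.2]
  refine le_of_sq_le_sq ?_ (add_nonneg (mul_nonneg ht1 dist_nonneg) (mul_nonneg ht.1 dist_nonneg))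
  nlinarith [mul_le_mul_of_nonneg_left h3 (mul_nonneg ht.1 ht1)]

/-- Two CAT(0) inequalities are chained: vertex `seg p q t` against the side `p q'`, then vertex
`q'` against the side `p q`. -/
theorem dist_seg_seg_le (p q q' : X) {t : ℝ} (ht : t ∈ Icc (0 : ℝ) 1) :
    dist (hX.seg p q t) (hX.seg p q' t) ≤ t * dist q q' := by
  have h1 := hX.dist_seg_sq_le (hX.seg p q t) p q' ht
  have h2 := hX.dist_seg_sq_le q' p q ht
  rw [dist_comm q' (hX.seg p q t), dist_comm q' p, dist_comm q' q] at h2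
  rw [dist_comm (hX.seg p q t) p, hX.dist_left_seg p q ht] at h1
  refine le_of_sq_le_sq ?_ (mul_nonneg ht.1 dist_nonneg)
  nlinarith [mul_le_mul_of_nonneg_left h2 ht.1]

omit hX in
/-- The point at distance `s` from `p` on the geodesic from `p` to `q`. -/
noncomputable def arc (hX : IsCAT0 X) (p q : X) (s : ℝ) : X := hX.seg p q (s / dist p q)

theorem dist_arc_arc (p q : X) {s t : ℝ} (hs : s ∈ Icc 0 (dist p q)) (ht : t ∈ Icc 0 (dist p q)) :
    dist (hX.arc p q s) (hX.arc p q t) = |s - t| := by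
  rw [arc, arc, hX.dist_seg_seg p q (div_mem_Icc_zero_one hs) (div_mem_Icc_zero_one ht)]
  rcases eq_or_ne (dist p q) 0 with h | h
  · rw [h] at hs ht ⊢
    rw [le_antisymm hs.2 hs.1, le_antisymm ht.2 ht.1]
    simp
  · rw [← sub_div, abs_div, abs_of_nonneg (dist_nonneg (x := p) (y := q)), div_mul_cancel₀ _ h]

theorem arc_zero (p q : X) : hX.arc p q 0 = p := by rw [arc, zero_div, hX.seg_zero]

theorem arc_dist (p q : X) : hX.arc p q (dist p q) = q := by
  rcases eq_or_ne p q with rfl | h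
  · rw [dist_self, hX.arc_zero]
  · rw [arc, div_self (dist_ne_zero.2 h), hX.seg_one]

theorem dist_left_arc (p q : X) {s : ℝ} (hs : s ∈ Icc 0 (dist p q)) :
    dist p (hX.arc p q s) = s := by
  have := hX.dist_arc_arc p q (s := 0) (by simp) hs
  rwa [hX.arc_zero, zero_sub, abs_neg, abs_of_nonneg hs.1] at this

theorem dist_arc_right (p q : X) {s : ℝ} (hs : s ∈ Icc 0 (dist p q)) :
    dist (hX.arc p q s) q = dist p q - s := by
  have := hX.dist_arc_arc p q hs (t := dist p q) (by simp)
  rwa [hX.arc_dist, abs_sub_comm, abs_of_nonneg (by linarith [hs.2])] at this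

/-- Inequalities suffice, as the triangle inequality forces both to be equalities. -/
theorem eq_arc {p q m : X} {s : ℝ} (h₁ : dist p m ≤ s) (h₂ : dist m q ≤ dist p q - s) :
    m = hX.arc p q s := by
  have h₃ := dist_triangle p m q
  have hs : s ∈ Icc 0 (dist p q) := ⟨dist_nonneg.trans h₁, by linarith [dist_nonneg (x := m) (y := q)]⟩
  rcases eq_or_ne p q with rfl | h
  · rw [dist_self] at hs
    rw [le_antisymm hs.2 hs.1] at h₁ ⊢
    rw [hX.arc_zero, dist_le_zero.1 h₁]
  · refine hX.eq_seg (div_mem_Icc_zero_one hs) ?_ ?_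
    · rw [div_mul_cancel₀ _ (dist_ne_zero.2 h)]
      linarith
    · rw [sub_mul, div_mul_cancel₀ _ (dist_ne_zero.2 h)]
      linarith

theorem arc_eq_arc_of_between {p q z : X} (h : dist p z = dist p q + dist q z) {s : ℝ}
    (hs : s ∈ Icc 0 (dist p q)) : hX.arc p q s = hX.arc p z s := by
  refine hX.eq_arc (hX.dist_left_arc p q hs).le ?_
  have := dist_triangle (hX.arc p q s) q z
  rw [hX.dist_arc_right p q hs] at this
  linarith

theorem dist_arc_arc_le {p q q' : X} (h : dist p q = dist p q') {s : ℝ}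
    (hs : s ∈ Icc 0 (dist p q)) :
    dist (hX.arc p q s) (hX.arc p q' s) ≤ s / dist p q * dist q q' := by
  rw [arc, arc, ← h]
  exact hX.dist_seg_seg_le p q q' (div_mem_Icc_zero_one hs)

end IsCAT0
end CAT0

/-! ### From infinitesimal slope to increase over a given distance -/

section Ekeland
variable {X : Type*} [MetricSpace X] [CompleteSpace X]

/-- If, above the level of `x`, a `1`-Lipschitz function can be increased with slope at least `a` by
arbitrarily small steps, then it can be increased with slope at least `a` up to any given
distance from `x`. -/
theorem exists_dist_eq_of_slope {f : X → ℝ} (hf : ∀ p q, |f p - f q| ≤ dist p q) {a : ℝ}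
    (ha : 0 < a) {x : X} (hstep : ∀ z, f x ≤ f z → ∀ δ > 0, ∃ z', z' ≠ z ∧ dist z z' < δ ∧
      a * dist z z' ≤ f z' - f z) {R : ℝ} (hR : 0 ≤ R) :
    ∃ z, dist x z = R ∧ a * R ≤ f z - f x := by
  have hcont : Continuous f :=
    (LipschitzWith.of_dist_le_mul (K := 1) fun p q => by
      rw [Real.dist_eq, NNReal.coe_one, one_mul]; exact hf p q).continuous
  let S : Set X := {z | dist x z ≤ R ∧ a * dist x z ≤ f z - f x}
  have hSc : IsClosed S := by
    have h1 : IsClosed {z | dist x z ≤ R} := isClosed_le (by fun_prop) (by fun_prop)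
    have h2 : IsClosed {z | a * dist x z ≤ f z - f x} := isClosed_le (by fun_prop) (by fun_prop)
    exact h1.inter h2
  -- Ekeland's order on `S`. Zorn's lemma gives a maximal element, which must lie at distance
  -- exactly `R` from `x`.
  let r : S → S → Prop := fun z z' => a * dist z.1 z'.1 ≤ f z' - f z
  have htrans : ∀ {u v w : S}, r u v → r v w → r u w := by
    intro u v w huv hvw
    have := mul_le_mul_of_nonneg_left (dist_triangle u.1 v.1 w.1) ha.le
    change a * _ ≤ _ at huv hvw ⊢
    linarith
  have hx : x ∈ S := by simp [S, hR]
  obtain ⟨m, hm⟩ : ∃ m : S, ∀ z, r m z → r z m := by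
    refine exists_maximal_of_chains_bounded (r := r) (fun c hc => ?_) htrans
    rcases c.eq_empty_or_nonempty with rfl | hne
    · exact ⟨⟨x, hx⟩, by simp⟩
    have hbdd : BddAbove ((fun z : S => f z) '' c) := by
      refine ⟨f x + R, ?_⟩
      rintro _ ⟨z, -, rfl⟩
      have h1 := (abs_le.1 (hf z.1 x)).2
      have h2 := z.2.1
      rw [dist_comm] at h1
      change f z.1 ≤ _
      linarith
    -- A sequence of the chain along which `f` tends to its supremum is Cauchy, because comparable
    -- points satisfy `a * dist ≤ |f - f|`. Its limit bounds the chain.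
    set s := sSup ((fun z : S => f z) '' c) with hs
    obtain ⟨u, -, hu, huc⟩ := exists_seq_tendsto_sSup (hne.image _) hbdd
    choose z hzc hzu using huc
    have hzu' : ∀ n, f (z n) = u n := hzu
    have hle : ∀ w ∈ c, f w ≤ s := fun w hw => le_csSup hbdd (mem_image_of_mem _ hw)
    have hcomp : ∀ w ∈ c, ∀ w' ∈ c, a * dist w.1 w'.1 ≤ |f w - f w'| := by
      intro w hw w' hw'
      rcases eq_or_ne w w' with rfl | hne
      · simp
      rcases hc hw hw' hne with h | h
      · exact h.trans (by rw [abs_sub_comm]; exact le_abs_self _)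
      · rw [dist_comm]
        exact le_trans h (le_abs_self _)
    have hcau : CauchySeq fun n => (z n).1 := by
      rw [Metric.cauchySeq_iff]
      intro ε hε
      obtain ⟨N, hN⟩ := Metric.cauchySeq_iff.1 hu.cauchySeq (a * ε) (by positivity)
      refine ⟨N, fun i hi j hj => ?_⟩
      have h1 := hcomp _ (hzc i) _ (hzc j)
      have h2 := hN i hi j hj
      rw [hzu', hzu', ← Real.dist_eq] at h1
      exact lt_of_mul_lt_mul_left (h1.trans_lt h2) ha.le
    obtain ⟨y, hy⟩ := cauchySeq_tendsto_of_complete hcau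
    have hyS : y ∈ S := hSc.mem_of_tendsto hy (Eventually.of_forall fun n => (z n).2)
    have hfy : f y = s := by
      refine tendsto_nhds_unique ((hcont.tendsto y).comp hy) ?_
      convert hu using 1
      exact funext hzu'
    refine ⟨⟨y, hyS⟩, fun w hw => ?_⟩
    have h1 : Tendsto (fun n => a * dist w.1 (z n).1) atTop (𝓝 (a * dist w.1 y)) :=
      (tendsto_const_nhds.dist hy).const_mul a
    have h2 : Tendsto (fun n => |f w - f (z n)|) atTop (𝓝 |f w - f y|) :=
      (tendsto_const_nhds.sub ((hcont.tendsto y).comp hy)).abs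
    have h3 := le_of_tendsto_of_tendsto' h1 h2 fun n => hcomp w hw _ (hzc n)
    change a * dist w.1 y ≤ f y - f w
    rwa [abs_sub_comm, abs_of_nonneg] at h3
    rw [hfy]
    linarith [hle w hw]
  have hmS := m.2
  refine ⟨m, ?_, ?_⟩
  all_goals
    have heq : dist x m = R := by
      by_contra hne
      have hlt : dist x m.1 < R := lt_of_le_of_ne hmS.1 hne
      -- A step shorter than `R - dist x m` stays in `S` and contradicts maximality.
      obtain ⟨z', hz', hd, hs⟩ := hstep m.1
        (by linarith [hmS.2, mul_nonneg ha.le (dist_nonneg (x := x) (y := m.1))])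
        (R - dist x m.1) (by linarith)
      have ht := dist_triangle x m.1 z'
      have hz'S : z' ∈ S := ⟨by linarith,
        by linarith [mul_le_mul_of_nonneg_left ht ha.le, hmS.2]⟩
      have h2 : a * dist z' m.1 ≤ f m.1 - f z' := hm ⟨z', hz'S⟩ hs
      have h3 : 0 < a * dist m.1 z' := mul_pos ha (dist_pos.2 hz'.symm)
      rw [dist_comm z' m.1] at h2
      linarith
  · exact heq
  · rw [← heq]
    exact hmS.2

end Ekeland

/-! ### First-order limits of curves, and the slope of the distance function -/

/-- An ultrafilter of positive reals tending to `0`. -/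
noncomputable def blowupFilter : Ultrafilter ℝ := Ultrafilter.of (𝓝[>] 0)

theorem blowupFilter_le : (blowupFilter : Filter ℝ) ≤ 𝓝[>] 0 := Ultrafilter.of_le _

theorem eventually_blowupFilter_mem_Ioo {r : ℝ} (hr : 0 < r) : ∀ᶠ t in blowupFilter, t ∈ Ioo 0 r :=
  blowupFilter_le (Ioo_mem_nhdsGT hr)

theorem tendsto_id_blowupFilter : Tendsto id (blowupFilter : Filter ℝ) (𝓝 0) :=
  blowupFilter_le.trans nhdsWithin_le_nhds

section Blowup
variable {X : Type*} [MetricSpace X] {V : Type*} [NormedAddCommGroup V] [InnerProductSpace ℝ V]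
  {x : X} (Φ : InfinitesimalChart V x)

/-- The curve `p` tends to `x` with first order behavior `a` in the chart `Φ`. -/
def IsBlowup (p : ℝ → X) (a : V) : Prop :=
  Tendsto p blowupFilter (𝓝 x) ∧ Tendsto (fun t => t⁻¹ • Φ.toFun (p t)) blowupFilter (𝓝 a)

variable {Φ}

/-- The chart distorts distances by factors tending to `1`, so rescaled distances converge to the
norm distance of the first-order limits. -/
theorem IsBlowup.tendsto_dist {p q : ℝ → X} {a b : V} (hp : IsBlowup Φ p a) (hq : IsBlowup Φ q b) :
    Tendsto (fun t => dist (p t) (q t) / t) blowupFilter (𝓝 ‖a - b‖) := by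
  have hN : Tendsto (fun t => ‖Φ.toFun (p t) - Φ.toFun (q t)‖ / t) blowupFilter (𝓝 ‖a - b‖) := by
    refine ((hp.2.sub hq.2).norm).congr' ?_
    filter_upwards [eventually_blowupFilter_mem_Ioo one_pos] with t ht
    rw [← smul_sub, norm_smul, norm_inv, Real.norm_of_nonneg ht.1.le, inv_mul_eq_div]
  refine tendsto_order.2 ⟨fun c hc => ?_, fun c hc => ?_⟩
  · obtain ⟨C, hC1, hC⟩ : ∃ C > 1, c * C < ‖a - b‖ := by
      have : Tendsto (fun C => c * C) (𝓝[>] 1) (𝓝 (c * 1)) :=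
        ((continuous_const_mul c).tendsto 1).mono_left nhdsWithin_le_nhds
      rw [mul_one] at this
      exact ((eventually_mem_nhdsWithin (a := (1 : ℝ)) (s := Ioi 1)).and (this.eventually (gt_mem_nhds hc))).exists
    obtain ⟨u, hu, h⟩ := Φ.norm_le C hC1
    filter_upwards [hN.eventually (lt_mem_nhds hC), hp.1 hu, hq.1 hu,
      eventually_blowupFilter_mem_Ioo one_pos] with t h1 h2 h3 ht
    have h4 := div_le_div_of_nonneg_right (h _ h2 _ h3) ht.1.le
    rw [mul_div_assoc] at h4
    have : c * C < dist (p t) (q t) / t * C := by linarith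
    exact lt_of_mul_lt_mul_right this (by linarith)
  · obtain ⟨C, hC1, hC⟩ : ∃ C > 1, C * ‖a - b‖ < c := by
      have : Tendsto (fun C => C * ‖a - b‖) (𝓝[>] 1) (𝓝 (1 * ‖a - b‖)) :=
        ((continuous_mul_const ‖a - b‖).tendsto 1).mono_left nhdsWithin_le_nhds
      rw [one_mul] at this
      exact ((eventually_mem_nhdsWithin (a := (1 : ℝ)) (s := Ioi 1)).and (this.eventually (gt_mem_nhds hc))).exists
    obtain ⟨u, hu, h⟩ := Φ.dist_le C hC1
    filter_upwards [(hN.const_mul C).eventually (gt_mem_nhds hC), hp.1 hu, hq.1 hu,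
      eventually_blowupFilter_mem_Ioo one_pos] with t h1 h2 h3 ht
    have h4 := div_le_div_of_nonneg_right (h _ h2 _ h3) ht.1.le
    rw [mul_div_assoc] at h4
    linarith

theorem IsBlowup.norm_sub_eq {p q : ℝ → X} {a b : V} (hp : IsBlowup Φ p a) (hq : IsBlowup Φ q b)
    {L : ℝ} (h : Tendsto (fun t => dist (p t) (q t) / t) blowupFilter (𝓝 L)) : ‖a - b‖ = L :=
  tendsto_nhds_unique (hp.tendsto_dist hq) h

variable (Φ) in
theorem isBlowup_const : IsBlowup Φ (fun _ => x) 0 :=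
  ⟨tendsto_const_nhds, by simp [Φ.map_base]⟩

theorem IsBlowup.tendsto_dist_base {p : ℝ → X} {a : V} (hp : IsBlowup Φ p a) :
    Tendsto (fun t => dist (p t) x / t) blowupFilter (𝓝 ‖a‖) := by
  simpa using hp.tendsto_dist (isBlowup_const Φ)

theorem IsBlowup.norm_eq {p : ℝ → X} {a : V} (hp : IsBlowup Φ p a) {L : ℝ}
    (h : ∀ᶠ t in blowupFilter, dist (p t) x = L * t) : ‖a‖ = L := by
  refine tendsto_nhds_unique hp.tendsto_dist_base (tendsto_const_nhds.congr' ?_)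
  filter_upwards [h, eventually_blowupFilter_mem_Ioo one_pos] with t h1 h2
  rw [h1, mul_div_cancel_right₀ _ h2.1.ne']

theorem IsBlowup.norm_sub_eq' {p q : ℝ → X} {a b : V} (hp : IsBlowup Φ p a) (hq : IsBlowup Φ q b)
    {L : ℝ} (h : ∀ᶠ t in blowupFilter, dist (p t) (q t) = L * t) : ‖a - b‖ = L := by
  refine hp.norm_sub_eq hq (tendsto_const_nhds.congr' ?_)
  filter_upwards [h, eventually_blowupFilter_mem_Ioo one_pos] with t h1 h2
  rw [h1, mul_div_cancel_right₀ _ h2.1.ne']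

theorem IsBlowup.congr {p q : ℝ → X} {a : V} (hp : IsBlowup Φ p a)
    (h : ∀ᶠ t in blowupFilter, p t = q t) : IsBlowup Φ q a :=
  ⟨hp.1.congr' h, hp.2.congr' (h.mono fun t ht => by rw [ht])⟩

theorem IsBlowup.unique {p : ℝ → X} {a b : V} (ha : IsBlowup Φ p a) (hb : IsBlowup Φ p b) :
    a = b := tendsto_nhds_unique ha.2 hb.2

-- Balls of `V` are compact, so along an ultrafilter every bounded rescaled curve converges, without
-- extracting subsequences.
variable (Φ) in
theorem exists_isBlowup [FiniteDimensional ℝ V] {p : ℝ → X} {K : ℝ}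
    (h : ∀ᶠ t in blowupFilter, dist (p t) x ≤ K * t) : ∃ a, IsBlowup Φ p a := by
  have hp : Tendsto p blowupFilter (𝓝 x) := by
    rw [tendsto_iff_dist_tendsto_zero]
    refine tendsto_of_tendsto_of_tendsto_of_le_of_le' tendsto_const_nhds ?_
      (Eventually.of_forall fun _ => dist_nonneg) h
    simpa using tendsto_id_blowupFilter.const_mul K
  obtain ⟨u, hu, hn⟩ := Φ.norm_le 2 one_lt_two
  have hb : ∀ᶠ t in blowupFilter, t⁻¹ • Φ.toFun (p t) ∈ Metric.closedBall (0 : V) (2 * K) := by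
    filter_upwards [h, hp hu, eventually_blowupFilter_mem_Ioo one_pos] with t h1 h2 ht
    have h3 := hn _ h2 _ (mem_of_mem_nhds hu)
    rw [Φ.map_base, sub_zero] at h3
    rw [mem_closedBall_zero_iff, norm_smul, norm_inv, Real.norm_of_nonneg ht.1.le,
      inv_mul_le_iff₀ ht.1]
    linarith
  have := FiniteDimensional.proper_real V
  obtain ⟨a, -, ha⟩ := (isCompact_closedBall (0 : V) (2 * K)).ultrafilter_le_nhds
    (blowupFilter.map fun t => t⁻¹ • Φ.toFun (p t)) (le_principal_iff.2 hb)
  exact ⟨a, hp, ha⟩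

variable (Φ) in
theorem isBlowup_invFun (a : V) : IsBlowup Φ (fun t => Φ.invFun (t • a)) a := by
  have h0 : Tendsto (fun t : ℝ => t • a) blowupFilter (𝓝 0) := by
    simpa using tendsto_id_blowupFilter.smul_const a
  refine ⟨Φ.tendsto_invFun.comp h0, tendsto_const_nhds.congr' ?_⟩
  filter_upwards [h0.eventually Φ.right_inv, eventually_blowupFilter_mem_Ioo one_pos] with t h1 ht
  rw [h1, smul_smul, inv_mul_cancel₀ ht.1.ne', one_smul]

theorem eq_neg_of_norm_sub_eq {a b : V} (ha : ‖a‖ = 1) (hb : ‖b‖ = 1) (h : ‖a - b‖ = 2) :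
    b = -a := by
  have h1 := parallelogram_law_with_norm ℝ a b
  rw [ha, hb, h] at h1
  have h2 : ‖a + b‖ = 0 := by nlinarith
  exact (neg_eq_of_add_eq_zero_right (norm_eq_zero.1 h2)).symm

/-- The distance to `y` increases at unit rate in some direction, at each point where the space is
infinitesimally Euclidean. -/
theorem exists_slope [FiniteDimensional ℝ V] (Φ : InfinitesimalChart V x) (hX : IsCAT0 X) {y : X}
    (hy : y ≠ x) {a δ : ℝ} (ha : a < 1) (hδ : 0 < δ) :
    ∃ z, z ≠ x ∧ dist x z < δ ∧ a * dist x z ≤ dist y z - dist y x := by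
  have hD : 0 < dist x y := dist_pos.2 hy.symm
  have hIcc : ∀ᶠ t in blowupFilter, t ∈ Icc 0 (dist x y) :=
    (eventually_blowupFilter_mem_Ioo hD).mono fun t ht => Ioo_subset_Icc_self ht
  have hcx : ∀ᶠ t in blowupFilter, dist (hX.arc x y t) x = 1 * t := by
    filter_upwards [hIcc] with t ht
    rw [dist_comm, hX.dist_left_arc x y ht, one_mul]
  obtain ⟨w, hw⟩ := exists_isBlowup Φ (hcx.mono fun t ht => ht.le)
  have hw1 : ‖w‖ = 1 := hw.norm_eq hcx
  -- The direction of increase is opposite to that of the geodesic to `y`.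
  have hz := isBlowup_invFun Φ (-w)
  set z : ℝ → X := fun t => Φ.invFun (t • -w)
  have hzx : Tendsto (fun t => dist (z t) x / t) blowupFilter (𝓝 1) := by
    simpa [hw1] using hz.tendsto_dist_base
  have hcz : Tendsto (fun t => dist (hX.arc x y t) (z t) / t) blowupFilter (𝓝 2) := by
    have := hw.tendsto_dist hz
    rwa [sub_neg_eq_add, ← two_smul ℝ w, norm_smul, hw1, Real.norm_ofNat, mul_one] at this
  set m : ℝ → X := fun t => hX.seg (hX.arc x y t) (z t) (1 / 2)
  have hhalf : (1 / 2 : ℝ) ∈ Icc (0 : ℝ) 1 := by norm_num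
  have hmc : ∀ t, dist (hX.arc x y t) (m t) = 1 / 2 * dist (hX.arc x y t) (z t) := fun t =>
    hX.dist_left_seg _ _ hhalf
  have hmz : ∀ t, dist (m t) (z t) = 1 / 2 * dist (hX.arc x y t) (z t) := fun t => by
    rw [hX.dist_seg_right _ _ hhalf]; norm_num
  obtain ⟨b, hb⟩ : ∃ b, IsBlowup Φ m b := by
    refine exists_isBlowup Φ (K := 3) ?_
    filter_upwards [hcz.eventually (gt_mem_nhds (show (2 : ℝ) < 4 by norm_num)), hcx,
      eventually_blowupFilter_mem_Ioo one_pos] with t h1 h2 ht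
    rw [div_lt_iff₀ ht.1] at h1
    have h3 := dist_triangle_left (m t) x (hX.arc x y t)
    rw [hmc] at h3
    linarith
  have hbw : ‖w - b‖ = 1 := by
    refine hw.norm_sub_eq hb ?_
    simp_rw [hmc, mul_div_assoc]
    convert hcz.const_mul (1 / 2) using 2
    norm_num
  have hbw' : ‖b + w‖ = 1 := by
    rw [← sub_neg_eq_add]
    refine hb.norm_sub_eq hz ?_
    simp_rw [hmz, mul_div_assoc]
    convert hcz.const_mul (1 / 2) using 2
    norm_num
  -- The limit of the midpoint is at distance `1` from both `w` and `-w`, so it is their Euclidean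
  -- midpoint: `m t` is at distance `o(t)` from `x`.
  have hb0 : b = 0 := by
    have h1 := parallelogram_law_with_norm ℝ b w
    rw [norm_sub_rev] at hbw
    rw [hbw, hbw', hw1] at h1
    have : ‖b‖ = 0 := by nlinarith [norm_nonneg b]
    exact norm_eq_zero.1 this
  have hmx : Tendsto (fun t => dist (m t) x / t) blowupFilter (𝓝 0) := by
    simpa [hb0] using hb.tendsto_dist_base
  have hl : Tendsto (fun t => 1 - 2 * (dist (m t) x / t) - a * (dist (z t) x / t)) blowupFilter
      (𝓝 (1 - 2 * 0 - a * 1)) := ((hmx.const_mul 2).const_sub 1).sub (hzx.const_mul a)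
  have hpos : (0 : ℝ) < 1 - 2 * 0 - a * 1 := by linarith
  obtain ⟨t, h1, h2, h3, h4, ht⟩ := ((hl.eventually (lt_mem_nhds hpos)).and
    ((hzx.eventually (lt_mem_nhds one_pos)).and ((hz.1.eventually (Metric.ball_mem_nhds x hδ)).and
    (hIcc.and (eventually_blowupFilter_mem_Ioo one_pos))))).exists
  refine ⟨z t, ?_, by rw [dist_comm]; exact h3, ?_⟩
  · rintro h
    rw [h, dist_self, zero_div] at h2
    exact lt_irrefl _ h2
  · have h5 := hX.dist_seg_le y (hX.arc x y t) (z t) hhalf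
    have h6 := dist_triangle y (m t) x
    have h7 := hX.dist_arc_right x y h4
    rw [dist_comm y (hX.arc x y t), h7] at h5
    change dist y (m t) ≤ _ at h5
    have h8 : 0 < t * (1 - 2 * (dist (m t) x / t) - a * (dist (z t) x / t)) := mul_pos ht.1 h1
    have h9 : t * (1 - 2 * (dist (m t) x / t) - a * (dist (z t) x / t)) =
        t - 2 * dist (m t) x - a * dist (z t) x := by
      field_simp [ht.1.ne']
    rw [dist_comm x (z t), dist_comm y x]
    rw [dist_comm y x] at h6
    linarith
end Blowup

/-! ### Extension of geodesics to complete geodesics -/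

/-- Near each point, distances agree to first order with those of a Euclidean space. -/
def IsInfinitesimallyEuclidean (X : Type*) [MetricSpace X] : Prop :=
  ∀ x : X, ∃ (V : Type) (_ : NormedAddCommGroup V) (_ : InnerProductSpace ℝ V)
    (_ : FiniteDimensional ℝ V), Nonempty (InfinitesimalChart V x)

theorem abs_dist_sub_dist_le {X : Type*} [MetricSpace X] (y p q : X) :
    |dist y p - dist y q| ≤ dist p q := by
  rw [dist_comm y, dist_comm y]
  exact abs_dist_sub_le p q y

section Extension
variable {X : Type*} [MetricSpace X] [CompleteSpace X] (hX : IsCAT0 X)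
  (hE : IsInfinitesimallyEuclidean X)
include hX hE

/-- The sphere of radius `r` is reached with average slopes tending to `1`; a limit point in the
compact ball attains slope exactly `1`. -/
theorem exists_extension_of_isCompact {x y : X} (hy : y ≠ x) {r : ℝ} (hr : 0 ≤ r)
    (hK : IsCompact (Metric.closedBall x r)) :
    ∃ z, dist x z = r ∧ dist y z = dist y x + r := by
  -- With `n + 2` in the denominator the slope is positive already for `n = 0`.
  have hstep : ∀ n : ℕ, ∃ z, dist x z = r ∧ (1 - 1 / ((n : ℝ) + 2)) * r ≤ dist y z - dist y x := by
    intro n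
    have hn : (0 : ℝ) ≤ n := n.cast_nonneg
    have hn1 : 1 / ((n : ℝ) + 2) < 1 := by rw [div_lt_one (by linarith)]; linarith
    refine exists_dist_eq_of_slope (f := dist y) (abs_dist_sub_dist_le y) (by linarith)
      (fun z hz δ hδ => ?_) hr
    obtain ⟨V, _, _, _, ⟨Φ⟩⟩ := hE z
    have hyz : y ≠ z := by
      rintro rfl
      rw [dist_self] at hz
      exact hy (dist_le_zero.1 hz)
    exact exists_slope Φ hX hyz (by linarith [show (0 : ℝ) < 1 / ((n : ℝ) + 2) by positivity]) hδ
  choose z hz hz' using hstep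
  obtain ⟨w, -, φ, hφ, hw⟩ := hK.tendsto_subseq (x := z)
    fun n => by rw [Metric.mem_closedBall, dist_comm, hz]
  have h1 : dist x w = r :=
    tendsto_nhds_unique (tendsto_const_nhds.dist hw) (by simp [hz])
  refine ⟨w, h1, le_antisymm (by linarith [dist_triangle y x w]) ?_⟩
  have h2 : Tendsto (fun n : ℕ => 1 / ((n : ℝ) + 2)) atTop (𝓝 0) := by
    have := (tendsto_one_div_add_atTop_nhds_zero_nat (𝕜 := ℝ)).comp (tendsto_add_atTop_nat 1)
    refine this.congr fun n => ?_
    simp only [Function.comp, Nat.cast_add, Nat.cast_one]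
    ring_nf
  have h3 := (((h2.const_sub 1).mul_const r).comp hφ.tendsto_atTop)
  have h4 := le_of_tendsto_of_tendsto' h3 ((tendsto_const_nhds (x := y)).dist hw |>.sub_const
    (dist y x)) fun n => hz' (φ n)
  linarith

/-- Small closed balls are compact, so slope exactly `1` is available by small steps everywhere at
or above the level of `x`. The slope argument applies again, now with `a = 1` and without
compactness of large balls. -/
theorem exists_extension [LocallyCompactSpace X] {x y : X} (hy : y ≠ x) {R : ℝ} (hR : 0 ≤ R) :
    ∃ z, dist x z = R ∧ dist y z = dist y x + R := by
  have hstep : ∀ z, dist y x ≤ dist y z → ∀ δ > 0, ∃ z', z' ≠ z ∧ dist z z' < δ ∧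
      1 * dist z z' ≤ dist y z' - dist y z := by
    intro z hz δ hδ
    have hyz : y ≠ z := by
      rintro rfl
      rw [dist_self] at hz
      exact hy (dist_le_zero.1 hz)
    obtain ⟨r, hr, hrδ, hK⟩ : ∃ r, 0 < r ∧ r < δ ∧ IsCompact (Metric.closedBall z r) := by
      obtain ⟨K, hK, hKz⟩ := exists_compact_mem_nhds z
      obtain ⟨ε, hε, h⟩ := Metric.nhds_basis_closedBall.mem_iff.1 hKz
      refine ⟨min ε (δ / 2), by positivity, (min_le_right _ _).trans_lt (by linarith), ?_⟩
      exact hK.of_isClosed_subset Metric.isClosed_closedBall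
        ((Metric.closedBall_subset_closedBall (min_le_left _ _)).trans h)
    obtain ⟨w, hw, hw'⟩ := exists_extension_of_isCompact hX hE hyz hr.le hK
    refine ⟨w, ?_, by linarith, by linarith⟩
    rintro rfl
    rw [dist_self] at hw
    exact hr.ne hw
  obtain ⟨z, hz, hz'⟩ := exists_dist_eq_of_slope (f := dist y) (abs_dist_sub_dist_le y) one_pos
    hstep hR
  exact ⟨z, hz, le_antisymm (by linarith [dist_triangle y x z]) (by linarith)⟩

/-- Two distinct points lie on a complete geodesic. -/
theorem exists_line [LocallyCompactSpace X] {x y : X} (hy : y ≠ x) :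
    ∃ γ : ℝ → X, (∀ s t, dist (γ s) (γ t) = |s - t|) ∧ γ 0 = x ∧ γ (dist x y) = y := by
  -- A segment is prolonged by length `1` at both ends.
  have step : ∀ ab : {ab : X × X // ab.1 ≠ ab.2}, ∃ cd : {cd : X × X // cd.1 ≠ cd.2},
      dist ab.1.1 cd.1.1 = 1 ∧ dist ab.1.2 cd.1.2 = 1 ∧
        dist cd.1.1 cd.1.2 = dist ab.1.1 ab.1.2 + 2 := by
    rintro ⟨⟨a, b⟩, hab⟩
    obtain ⟨d, hd, hd'⟩ := exists_extension hX hE (x := b) (y := a) hab zero_le_one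
    have hda : d ≠ a := by
      rintro rfl
      rw [dist_self] at hd'
      linarith [dist_nonneg (x := d) (y := b)]
    obtain ⟨c, hc, hc'⟩ := exists_extension hX hE (x := a) (y := d) hda zero_le_one
    have hcd : dist c d = dist a b + 2 := by
      rw [dist_comm c d, hc', dist_comm d a, hd']; ring
    refine ⟨⟨(c, d), ?_⟩, hc, hd, hcd⟩
    exact dist_pos.1 (by linarith [dist_nonneg (x := a) (y := b)])
  choose f hf₁ hf₂ hf₃ using step
  let u : ℕ → {ab : X × X // ab.1 ≠ ab.2} := fun n => f^[n] ⟨(x, y), hy.symm⟩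
  have hu : ∀ n, u (n + 1) = f (u n) := fun n => Function.iterate_succ_apply' f n _
  have hD : ∀ n : ℕ, dist (u n).1.1 (u n).1.2 = dist x y + 2 * n := by
    intro n
    induction n with
    | zero => simp [u]
    | succ n ih => rw [hu, hf₃, ih]; push_cast; ring
  -- The `n`-th segment, shifted so that time `0` is at `x`. It is meaningful for `-n ≤ t ≤ dist x y
  -- + n`, and uniqueness of geodesics makes these arcs agree on common times.
  let P : ℕ → ℝ → X := fun n t => hX.arc (u n).1.1 (u n).1.2 (n + t)
  have hmem : ∀ (n : ℕ) (t : ℝ), -n ≤ t → t ≤ dist x y + n →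
      (n + t : ℝ) ∈ Icc 0 (dist (u n).1.1 (u n).1.2) := by
    intro n t h1 h2
    rw [hD]
    exact ⟨by linarith, by linarith⟩
  have hsucc : ∀ (n : ℕ) (t : ℝ), -n ≤ t → t ≤ dist x y + n → P n t = P (n + 1) t := by
    intro n t h1 h2
    have hm := hmem n t h1 h2
    refine hX.eq_arc ?_ ?_
    · have h3 := dist_triangle (u (n + 1)).1.1 (u n).1.1 (P n t)
      rw [hX.dist_left_arc _ _ hm, hu, dist_comm (f (u n)).1.1 (u n).1.1, hf₁] at h3
      rw [hu]
      push_cast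
      linarith
    · have h3 := dist_triangle (P n t) (u n).1.2 (u (n + 1)).1.2
      rw [hX.dist_arc_right _ _ hm, hu, hf₂] at h3
      rw [hD, ← hu] at *
      push_cast
      linarith
  have hle : ∀ (n m : ℕ) (t : ℝ), n ≤ m → -n ≤ t → t ≤ dist x y + n → P n t = P m t := by
    intro n m t hnm h1 h2
    induction m, hnm using Nat.le_induction with
    | base => rfl
    | succ m hm ih =>
      have hm' : (n : ℝ) ≤ m := by exact_mod_cast hm
      rw [ih, hsucc m t (by linarith) (by linarith)]
  have hdxy := dist_nonneg (x := x) (y := y)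
  have hP : ∀ (n : ℕ) (t : ℝ), |t| ≤ n → P ⌈|t|⌉₊ t = P n t := by
    intro n t h
    have h1 := abs_le.1 (Nat.le_ceil |t|)
    exact hle _ n t (Nat.ceil_le.2 h) h1.1 (by linarith)
  refine ⟨fun t => P ⌈|t|⌉₊ t, fun s t => ?_, ?_, ?_⟩
  · have hs : |s| ≤ (max ⌈|s|⌉₊ ⌈|t|⌉₊ : ℕ) :=
      (Nat.le_ceil _).trans (by exact_mod_cast le_max_left _ _)
    have ht : |t| ≤ (max ⌈|s|⌉₊ ⌈|t|⌉₊ : ℕ) :=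
      (Nat.le_ceil _).trans (by exact_mod_cast le_max_right _ _)
    simp only
    rw [hP _ s hs, hP _ t ht]
    have hs' := abs_le.1 hs
    have ht' := abs_le.1 ht
    rw [hX.dist_arc_arc _ _ (hmem _ s hs'.1 (by linarith)) (hmem _ t ht'.1 (by linarith)),
      add_sub_add_left_eq_sub]
  · have : P 0 0 = x := by simp [P, u, hX.arc_zero]
    simpa using this
  · have : P 0 (dist x y) = y := by simp [P, u, hX.arc_dist]
    simp only
    rw [← hle 0 _ _ (Nat.zero_le _) (by simp) (by simp), this]
end Extension

/-! ### Directions of geodesics at a point and first variation -/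

section Direction
variable {X : Type*} [MetricSpace X] {V : Type*} [NormedAddCommGroup V] [InnerProductSpace ℝ V]
  {x : X} (Φ : InfinitesimalChart V x) (hX : IsCAT0 X)

/-- The geodesic from `x` to `y` leaves `x` in the direction `w`. -/
def HasDir (y : X) (w : V) : Prop := IsBlowup Φ (hX.arc x y) w

variable {Φ hX}

theorem eventually_mem_Icc_dist {y : X} (hy : y ≠ x) :
    ∀ᶠ t in blowupFilter, t ∈ Icc 0 (dist x y) :=
  (eventually_blowupFilter_mem_Ioo (dist_pos.2 hy.symm)).mono fun _ ht => Ioo_subset_Icc_self ht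

theorem eventually_dist_arc {y : X} (hy : y ≠ x) :
    ∀ᶠ t in blowupFilter, dist (hX.arc x y t) x = 1 * t := by
  filter_upwards [eventually_mem_Icc_dist hy] with t ht
  rw [dist_comm, hX.dist_left_arc x y ht, one_mul]

variable (Φ hX) in
theorem exists_hasDir [FiniteDimensional ℝ V] {y : X} (hy : y ≠ x) : ∃ w, HasDir Φ hX y w :=
  exists_isBlowup Φ ((eventually_dist_arc hy).mono fun _ ht => ht.le)

theorem HasDir.norm_eq {y : X} (hy : y ≠ x) {w : V} (h : HasDir Φ hX y w) : ‖w‖ = 1 :=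
  IsBlowup.norm_eq h (eventually_dist_arc hy)

theorem HasDir.of_between {y z : X} (hy : y ≠ x) {w : V} (h : HasDir Φ hX y w)
    (hz : dist x z = dist x y + dist y z) : HasDir Φ hX z w := by
  refine IsBlowup.congr h ?_
  filter_upwards [eventually_mem_Icc_dist hy] with t ht
  exact hX.arc_eq_arc_of_between hz ht

/-- By comparison, the points at distance `t` from `x` on the two geodesics are at most `t / dist x
y * dist y y'` apart; divide by `t` and let `t` tend to `0`. -/
theorem HasDir.norm_sub_mul_le_of_dist_eq {y y' : X} (hy : y ≠ x) {w w' : V}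
    (h : HasDir Φ hX y w) (h' : HasDir Φ hX y' w') (hd : dist x y = dist x y') :
    ‖w - w'‖ * dist x y ≤ dist y y' := by
  have h0 : 0 < dist x y := dist_pos.2 hy.symm
  rw [← le_div_iff₀ h0]
  refine le_of_tendsto (IsBlowup.tendsto_dist h h') ?_
  filter_upwards [eventually_mem_Icc_dist hy, eventually_blowupFilter_mem_Ioo one_pos] with t ht ht'
  rw [div_le_iff₀ ht'.1]
  refine (hX.dist_arc_arc_le hd ht).trans (le_of_eq ?_)
  ring

theorem HasDir.norm_sub_mul_le_of_le {y y' : X} (hy : y ≠ x) {w w' : V}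
    (h : HasDir Φ hX y w) (h' : HasDir Φ hX y' w') (hd : dist x y ≤ dist x y') :
    ‖w - w'‖ * dist x y ≤ dist y y' + (dist x y' - dist x y) := by
  have h0 : 0 < dist x y := dist_pos.2 hy.symm
  have hmem : dist x y ∈ Icc 0 (dist x y') := ⟨h0.le, hd⟩
  set z := hX.arc x y' (dist x y)
  have hz : dist x z = dist x y := hX.dist_left_arc x y' hmem
  have hzy : dist z y' = dist x y' - dist x y := hX.dist_arc_right x y' hmem
  have hdir : HasDir Φ hX z w' := by
    refine IsBlowup.congr h' ?_
    filter_upwards [eventually_mem_Icc_dist hy] with t ht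
    exact (hX.arc_eq_arc_of_between (by rw [hz, hzy]; ring) (by rwa [hz])).symm
  have h1 := h.norm_sub_mul_le_of_dist_eq hy hdir hz.symm
  have h2 := dist_triangle_right y z y'
  linarith

theorem HasDir.norm_sub_mul_le {y y' : X} (hy : y ≠ x) (hy' : y' ≠ x) {w w' : V}
    (h : HasDir Φ hX y w) (h' : HasDir Φ hX y' w') :
    ‖w - w'‖ * min (dist x y) (dist x y') ≤ dist y y' + |dist x y' - dist x y| := by
  rcases le_total (dist x y) (dist x y') with hd | hd
  · rw [min_eq_left hd, abs_of_nonneg (by linarith)]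
    exact h.norm_sub_mul_le_of_le hy h' hd
  · rw [min_eq_right hd, abs_of_nonpos (by linarith), norm_sub_rev, dist_comm y y', neg_sub]
    exact h'.norm_sub_mul_le_of_le hy' h hd

/-- A line through `x` has opposite directions on its two sides. -/
theorem exists_isBlowup_line [FiniteDimensional ℝ V] (Φ : InfinitesimalChart V x) {γ : ℝ → X}
    (hγ : ∀ s t, dist (γ s) (γ t) = |s - t|) (h0 : γ 0 = x) :
    ∃ w, ‖w‖ = 1 ∧ IsBlowup Φ γ w ∧ IsBlowup Φ (fun t => γ (-t)) (-w) := by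
  have hp : ∀ᶠ t in blowupFilter, dist (γ t) x = 1 * t := by
    filter_upwards [eventually_blowupFilter_mem_Ioo one_pos] with t ht
    rw [← h0, hγ, sub_zero, abs_of_pos ht.1, one_mul]
  have hm : ∀ᶠ t in blowupFilter, dist (γ (-t)) x = 1 * t := by
    filter_upwards [eventually_blowupFilter_mem_Ioo one_pos] with t ht
    rw [← h0, hγ, sub_zero, abs_neg, abs_of_pos ht.1, one_mul]
  obtain ⟨w, hw⟩ := exists_isBlowup Φ (hp.mono fun _ h => h.le)
  obtain ⟨w', hw'⟩ := exists_isBlowup Φ (hm.mono fun _ h => h.le)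
  have hsub : ‖w - w'‖ = 2 := by
    refine hw.norm_sub_eq' hw' ?_
    filter_upwards [eventually_blowupFilter_mem_Ioo one_pos] with t ht
    rw [hγ, sub_neg_eq_add, abs_of_pos (by linarith [ht.1])]
    ring
  rw [eq_neg_of_norm_sub_eq (hw.norm_eq hp) (hw'.norm_eq hm) hsub] at hw'
  exact ⟨w, hw.norm_eq hp, hw, hw'⟩

theorem hasDir_line_iff {γ : ℝ → X} (hγ : ∀ s t, dist (γ s) (γ t) = |s - t|) (h0 : γ 0 = x)
    {r : ℝ} (hr : 0 < r) {w : V} : HasDir Φ hX (γ r) w ↔ IsBlowup Φ γ w := by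
  have h : ∀ᶠ t in blowupFilter, γ t = hX.arc x (γ r) t := by
    filter_upwards [eventually_blowupFilter_mem_Ioo hr] with t ht
    refine hX.eq_arc ?_ ?_
    · rw [← h0, hγ, zero_sub, abs_neg, abs_of_pos ht.1]
    · rw [← h0, hγ, hγ, zero_sub, abs_neg, abs_of_pos hr, abs_sub_comm,
        abs_of_pos (by linarith [ht.2])]
  exact ⟨fun H => IsBlowup.congr H (h.mono fun _ h => h.symm), fun H => H.congr h⟩

theorem HasDir.neg_line [FiniteDimensional ℝ V] {γ : ℝ → X}
    (hγ : ∀ s t, dist (γ s) (γ t) = |s - t|) (h0 : γ 0 = x) {r s : ℝ} (hr : 0 < r) (hs : 0 < s)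
    {w : V} (h : HasDir Φ hX (γ r) w) : HasDir Φ hX (γ (-s)) (-w) := by
  obtain ⟨w', -, h1, h2⟩ := exists_isBlowup_line Φ hγ h0
  rw [hasDir_line_iff hγ h0 hr] at h
  rw [h.unique h1]
  exact (hasDir_line_iff (γ := fun t => γ (-t)) (fun s t => by rw [hγ, neg_sub_neg, abs_sub_comm])
    (by simpa using h0) hs).2 h2

/-- First variation: if the distance to `y` does not decrease along `p`, then `p` does not
leave `x` at an acute angle with the geodesic to `y`. -/
theorem HasDir.inner_nonpos [FiniteDimensional ℝ V] {y : X} (hy : y ≠ x) {w u : V}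
    (h : HasDir Φ hX y w)
    {p : ℝ → X} (hp : IsBlowup Φ p u) (hdist : ∀ᶠ t in blowupFilter, dist y x ≤ dist y (p t)) :
    inner ℝ w u ≤ 0 := by
  have hw1 := h.norm_eq hy
  -- The point at distance `K * t` on the geodesic to `y` is at least `K * t` away from `p t`. In
  -- the limit `K ≤ ‖K • w - u‖`; expand the square.
  have key : ∀ K : ℝ, 1 ≤ K → 2 * K * inner ℝ w u ≤ ‖u‖ ^ 2 := by
    intro K hK
    have hK0 : 0 < K := by linarith
    have hmem : ∀ᶠ t in blowupFilter, K * t ∈ Icc 0 (dist x y) := by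
      filter_upwards [eventually_blowupFilter_mem_Ioo (div_pos (dist_pos.2 hy.symm) hK0)] with t ht
      refine ⟨mul_nonneg hK0.le ht.1.le, ?_⟩
      rw [mul_comm]
      exact ((lt_div_iff₀ hK0).1 ht.2).le
    have hq : ∀ᶠ t in blowupFilter, dist (hX.arc x y (K * t)) x = K * t := by
      filter_upwards [hmem] with t ht
      rw [dist_comm, hX.dist_left_arc x y ht]
    obtain ⟨b, hb⟩ := exists_isBlowup Φ (hq.mono fun _ ht => ht.le)
    have hbK := hb.norm_eq hq
    have hbw : ‖b - w‖ = K - 1 := by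
      refine hb.norm_sub_eq' h ?_
      filter_upwards [hmem, eventually_mem_Icc_dist hy] with t ht ht'
      have : 0 ≤ (K - 1) * t := mul_nonneg (by linarith) ht'.1
      rw [hX.dist_arc_arc x y ht ht', ← abs_of_nonneg this]
      congr 1
      ring
    -- The ultrafilter is not assumed invariant under `t ↦ K * t`, so this limit is found from its
    -- norm `K` and its distance `K - 1` to `w`.
    have hbKw : b = K • w := by
      have h1 := norm_sub_sq_real b w
      have h2 := norm_sub_sq_real b (K • w)
      rw [hbw, hbK, hw1] at h1
      rw [inner_smul_right, norm_smul, hbK, hw1, Real.norm_of_nonneg hK0.le] at h2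
      have h3 : ‖b - K • w‖ ^ 2 = 0 := by rw [h2]; linear_combination -K * h1
      exact sub_eq_zero.1 (norm_eq_zero.1 (pow_eq_zero_iff two_ne_zero |>.1 h3))
    subst hbKw
    have hle : K ≤ ‖K • w - u‖ := by
      refine ge_of_tendsto (hb.tendsto_dist hp) ?_
      filter_upwards [hdist, hmem, eventually_blowupFilter_mem_Ioo one_pos] with t h1 h2 ht
      rw [le_div_iff₀ ht.1]
      have h3 := dist_triangle y (hX.arc x y (K * t)) (p t)
      rw [dist_comm y (hX.arc x y (K * t)), hX.dist_arc_right x y h2] at h3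
      rw [dist_comm y x] at h1
      linarith
    have h1 := norm_sub_sq_real (K • w) u
    rw [inner_smul_left, hbK] at h1
    have h2 : K ^ 2 ≤ ‖K • w - u‖ ^ 2 := pow_le_pow_left₀ hK0.le hle 2
    simp only [conj_trivial] at h1
    linarith
  by_contra! hneg
  -- For this `K`, the positive number `K * inner ℝ w u` is at least `‖u‖ ^ 2`, against `key`.
  have h1 := key (max 1 (‖u‖ ^ 2 / inner ℝ w u)) (le_max_left _ _)
  have h2 := (div_le_iff₀ hneg).1 (le_max_right 1 (‖u‖ ^ 2 / inner ℝ w u))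
  have h3 : 0 < max 1 (‖u‖ ^ 2 / inner ℝ w u) * inner ℝ w u :=
    mul_pos (lt_of_lt_of_le one_pos (le_max_left _ _)) hneg
  linarith

/-- A point projecting to `x` on a line through `x` is seen from `x` in a direction orthogonal to
the line. -/
theorem HasDir.inner_eq_zero [FiniteDimensional ℝ V] {y : X} (hy : y ≠ x) {w u : V}
    (h : HasDir Φ hX y w) {γ : ℝ → X} (hγ : ∀ s t, dist (γ s) (γ t) = |s - t|) (h0 : γ 0 = x)
    (hu : IsBlowup Φ γ u) (hmin : ∀ t, dist y x ≤ dist y (γ t)) : inner ℝ w u = 0 := by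
  obtain ⟨u', -, h1, h2⟩ := exists_isBlowup_line Φ hγ h0
  rw [← hu.unique h1] at h2
  have h3 := h.inner_nonpos hy hu (Eventually.of_forall fun t => hmin t)
  have h4 := h.inner_nonpos hy h2 (Eventually.of_forall fun t => hmin (-t))
  rw [inner_neg_right] at h4
  linarith

end Direction

/-! ### An isometry of the unit tangent sphere onto directions of complete geodesics -/

section LimitDirection
variable {X : Type*} [MetricSpace X] {V : Type*} [NormedAddCommGroup V] [InnerProductSpace ℝ V]
  {x : X} (Φ : InfinitesimalChart V x) (hX : IsCAT0 X)

/-- The direction of the geodesic from `x` to `p t` tends to `w` along the blow-up. -/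
def HasLimDir (p : ℝ → X) (w : V) : Prop :=
  ∃ d : ℝ → V, (∀ᶠ t in blowupFilter, HasDir Φ hX (p t) (d t)) ∧ Tendsto d blowupFilter (𝓝 w)

variable {Φ hX}

theorem IsBlowup.eventually_ne {p : ℝ → X} {v : V} (hp : IsBlowup Φ p v) (hv : ‖v‖ = 1) :
    ∀ᶠ t in blowupFilter, p t ≠ x := by
  filter_upwards [hp.tendsto_dist_base.eventually (lt_mem_nhds (show (0 : ℝ) < ‖v‖ by simp [hv]))]
    with t ht h
  rw [h, dist_self, zero_div] at ht
  exact lt_irrefl _ ht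

variable (hX) in
theorem IsBlowup.exists_hasLimDir [FiniteDimensional ℝ V] {p : ℝ → X} {v : V}
    (hp : IsBlowup Φ p v) (hv : ‖v‖ = 1) : ∃ w, HasLimDir Φ hX p w := by
  have h : ∀ t, ∃ w, p t ≠ x → HasDir Φ hX (p t) w := fun t => by
    by_cases ht : p t ≠ x
    · obtain ⟨w, hw⟩ := exists_hasDir Φ hX ht
      exact ⟨w, fun _ => hw⟩
    · exact ⟨0, fun h => absurd h ht⟩
  choose d hd using h
  have hb : ∀ᶠ t in blowupFilter, d t ∈ Metric.closedBall (0 : V) 1 := by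
    filter_upwards [hp.eventually_ne hv] with t ht
    rw [mem_closedBall_zero_iff, (hd t ht).norm_eq ht]
  have := FiniteDimensional.proper_real V
  obtain ⟨w, -, hw⟩ := (isCompact_closedBall (0 : V) 1).ultrafilter_le_nhds
    (blowupFilter.map d) (le_principal_iff.2 hb)
  exact ⟨w, d, (hp.eventually_ne hv).mono fun t ht => hd t ht, hw⟩

theorem HasLimDir.norm_eq {p : ℝ → X} {v w : V} (hp : IsBlowup Φ p v) (hv : ‖v‖ = 1)
    (h : HasLimDir Φ hX p w) : ‖w‖ = 1 := by
  obtain ⟨d, hd, hw⟩ := h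
  refine tendsto_nhds_unique hw.norm (tendsto_const_nhds.congr' ?_)
  filter_upwards [hd, hp.eventually_ne hv] with t h1 h2
  rw [h1.norm_eq h2]

/-- Limit of `HasDir.norm_sub_mul_le` divided by `t`; the difference of lengths disappears since `v`
and `v'` both have norm `1`. -/
theorem HasLimDir.norm_sub_le {p p' : ℝ → X} {v v' w w' : V} (hp : IsBlowup Φ p v)
    (hp' : IsBlowup Φ p' v') (hv : ‖v‖ = 1) (hv' : ‖v'‖ = 1) (h : HasLimDir Φ hX p w)
    (h' : HasLimDir Φ hX p' w') : ‖w - w'‖ ≤ ‖v - v'‖ := by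
  obtain ⟨d, hd, hw⟩ := h
  obtain ⟨d', hd', hw'⟩ := h'
  have h1 : Tendsto (fun t => ‖d t - d' t‖ * min (dist (p t) x / t) (dist (p' t) x / t))
      blowupFilter (𝓝 (‖w - w'‖ * min ‖v‖ ‖v'‖)) :=
    (hw.sub hw').norm.mul (hp.tendsto_dist_base.min hp'.tendsto_dist_base)
  have h2 : Tendsto (fun t => dist (p t) (p' t) / t + |dist (p' t) x / t - dist (p t) x / t|)
      blowupFilter (𝓝 (‖v - v'‖ + |‖v'‖ - ‖v‖|)) :=
    (hp.tendsto_dist hp').add (hp'.tendsto_dist_base.sub hp.tendsto_dist_base).abs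
  rw [hv, hv', min_self, mul_one] at h1
  rw [hv, hv', sub_self, abs_zero, add_zero] at h2
  refine le_of_tendsto_of_tendsto h1 h2 ?_
  filter_upwards [hd, hd', hp.eventually_ne hv, hp'.eventually_ne hv',
    eventually_blowupFilter_mem_Ioo one_pos] with t h3 h4 h5 h6 ht
  have h7 := h3.norm_sub_mul_le h5 h6 h4
  rw [min_div_div_right ht.1.le, ← sub_div, abs_div, abs_of_pos ht.1, ← add_div, ← mul_div_assoc,
    dist_comm (p t) x, dist_comm (p' t) x]
  exact div_le_div_of_nonneg_right h7 ht.1.le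

variable [FiniteDimensional ℝ V] [CompleteSpace X] [LocallyCompactSpace X]

/-- Prolong the geodesic from `p t` to `x` by length `t` beyond `x`. The limit of the new endpoint
has norm `1` and is at distance `2` from `v`, so it is `-v`, while the directions are exactly
opposite. -/
theorem HasLimDir.exists_neg (hE : IsInfinitesimallyEuclidean X) {p : ℝ → X} {v w : V}
    (hp : IsBlowup Φ p v) (hv : ‖v‖ = 1) (h : HasLimDir Φ hX p w) :
    ∃ q, IsBlowup Φ q (-v) ∧ HasLimDir Φ hX q (-w) := by
  obtain ⟨d, hd, hw⟩ := h
  have hline : ∀ t, ∃ γ : ℝ → X, p t ≠ x → (∀ s t, dist (γ s) (γ t) = |s - t|) ∧ γ 0 = x ∧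
      γ (dist x (p t)) = p t := fun t => by
    by_cases ht : p t ≠ x
    · obtain ⟨γ, hγ⟩ := exists_line hX hE ht
      exact ⟨γ, fun _ => hγ⟩
    · exact ⟨fun _ => x, fun h => absurd h ht⟩
  choose γ hγ using hline
  have hqx : ∀ᶠ t in blowupFilter, dist (γ t (-t)) x = 1 * t := by
    filter_upwards [hp.eventually_ne hv, eventually_blowupFilter_mem_Ioo one_pos] with t h1 ht
    conv_lhs => rw [← (hγ t h1).2.1]
    rw [(hγ t h1).1, sub_zero, abs_neg, abs_of_pos ht.1, one_mul]
  obtain ⟨b, hb⟩ := exists_isBlowup Φ (hqx.mono fun _ h => h.le)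
  have hvb : ‖v - b‖ = 2 := by
    refine hp.norm_sub_eq hb ?_
    have : Tendsto (fun t => dist (p t) x / t + 1) blowupFilter (𝓝 2) := by
      have := hp.tendsto_dist_base.add_const 1
      rwa [hv, one_add_one_eq_two] at this
    refine this.congr' ?_
    filter_upwards [hp.eventually_ne hv, eventually_blowupFilter_mem_Ioo one_pos] with t h1 ht
    obtain ⟨h2, h3, h4⟩ := hγ t h1
    have h5 : dist (p t) (γ t (-t)) = dist (p t) x + t := by
      conv_lhs => rw [← h4]
      rw [h2, sub_neg_eq_add, abs_of_nonneg (add_nonneg dist_nonneg ht.1.le), dist_comm]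
    rw [h5, add_div, div_self ht.1.ne']
  rw [eq_neg_of_norm_sub_eq hv (hb.norm_eq hqx) hvb] at hb
  refine ⟨_, hb, fun t => -d t, ?_, hw.neg⟩
  filter_upwards [hp.eventually_ne hv, eventually_blowupFilter_mem_Ioo one_pos, hd] with t h1 ht h6
  obtain ⟨h2, h3, h4⟩ := hγ t h1
  rw [← h4] at h6
  exact h6.neg_line h2 h3 (dist_pos.2 h1.symm) ht.1

/-- Prolong the geodesics from `x` to `p t` up to a fixed radius. Their endpoints accumulate at some
`y`, and comparison on the sphere shows that the geodesic to `y` has direction `w`. -/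
theorem HasLimDir.exists_line (hE : IsInfinitesimallyEuclidean X) {p : ℝ → X} {v w : V}
    (hp : IsBlowup Φ p v) (hv : ‖v‖ = 1) (h : HasLimDir Φ hX p w) :
    ∃ γ : ℝ → X, (∀ s t, dist (γ s) (γ t) = |s - t|) ∧ γ 0 = x ∧ IsBlowup Φ γ w := by
  obtain ⟨d, hd, hw⟩ := h
  obtain ⟨r, hr, hK⟩ : ∃ r, 0 < r ∧ IsCompact (Metric.closedBall x r) := by
    obtain ⟨K, hK, hKx⟩ := exists_compact_mem_nhds x
    obtain ⟨ε, hε, h⟩ := Metric.nhds_basis_closedBall.mem_iff.1 hKx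
    exact ⟨ε, hε, hK.of_isClosed_subset Metric.isClosed_closedBall h⟩
  have hz : ∀ t, ∃ z : X, p t ≠ x → dist x (p t) < r → dist x z = r ∧
      dist x z = dist x (p t) + dist (p t) z := fun t => by
    by_cases ht : p t ≠ x ∧ dist x (p t) < r
    · obtain ⟨γ, h1, h2, h3⟩ := PerpRadon.exists_line hX hE ht.1
      have h4 : dist x (γ r) = r := by rw [← h2, h1, zero_sub, abs_neg, abs_of_pos hr]
      refine ⟨γ r, fun _ _ => ⟨h4, ?_⟩⟩
      have h5 : dist (p t) (γ r) = r - dist x (p t) := by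
        conv_lhs => rw [← h3]
        rw [h1, abs_sub_comm, abs_of_pos (by linarith [ht.2])]
      rw [h4, h5]
      ring
    · exact ⟨x, fun h1 h2 => absurd ⟨h1, h2⟩ ht⟩
  choose z hz using hz
  have hzr : ∀ᶠ t in blowupFilter, p t ≠ x ∧ dist x (z t) = r ∧
      dist x (z t) = dist x (p t) + dist (p t) (z t) := by
    filter_upwards [hp.eventually_ne hv, hp.1.eventually (Metric.ball_mem_nhds x hr)] with t h1 h2
    exact ⟨h1, hz t h1 (by rw [dist_comm]; exact h2)⟩
  obtain ⟨y, -, hy⟩ := hK.ultrafilter_le_nhds (blowupFilter.map z) (le_principal_iff.2 (by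
    refine hzr.mono fun t ht => ?_
    rw [Metric.mem_closedBall, dist_comm, ht.2.1]))
  have hy' : Tendsto z blowupFilter (𝓝 y) := hy
  have hyr : dist x y = r := tendsto_nhds_unique (tendsto_const_nhds.dist hy')
    (tendsto_const_nhds.congr' (hzr.mono fun t ht => ht.2.1.symm))
  have hyx : y ≠ x := by
    rintro rfl
    rw [dist_self] at hyr
    exact hr.ne hyr
  obtain ⟨w', hw'⟩ := exists_hasDir Φ hX hyx
  have hww' : w = w' := by
    have h1 : Tendsto (fun t => ‖d t - w'‖ * r) blowupFilter (𝓝 (‖w - w'‖ * r)) :=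
      (hw.sub_const w').norm.mul_const r
    have h2 : Tendsto (fun t => dist (z t) y) blowupFilter (𝓝 (dist y y)) :=
      hy'.dist tendsto_const_nhds
    have h3 : ‖w - w'‖ * r ≤ dist y y := by
      refine le_of_tendsto_of_tendsto h1 h2 ?_
      filter_upwards [hd, hzr] with t h3 ht
      have hzx : z t ≠ x := by
        intro h
        rw [h, dist_self] at ht
        exact hr.ne ht.2.1
      have := (h3.of_between ht.1 ht.2.2).norm_sub_mul_le_of_dist_eq hzx hw' (ht.2.1.trans hyr.symm)
      rwa [ht.2.1] at this
    rw [dist_self] at h3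
    have h4 : ‖w - w'‖ ≤ 0 := by
      by_contra! h
      linarith [mul_pos h hr]
    exact sub_eq_zero.1 (norm_le_zero_iff.1 h4)
  obtain ⟨γ, h1, h2, h3⟩ := PerpRadon.exists_line hX hE hyx
  refine ⟨γ, h1, h2, ?_⟩
  rw [← hasDir_line_iff (hX := hX) h1 h2 hr, ← hyr, h3, hww']
  exact hw'

variable (Φ) in
/-- An isometric self-map of the unit sphere of the tangent space, each value of which is the
direction of a complete geodesic. -/
theorem exists_directions (hX : IsCAT0 X) (hE : IsInfinitesimallyEuclidean X) :
    ∃ F : V → V, (∀ v, ‖v‖ = 1 → ∀ v', ‖v'‖ = 1 → inner ℝ (F v) (F v') = inner ℝ v v') ∧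
      ∀ v, ‖v‖ = 1 → ∃ γ : ℝ → X, (∀ s t, dist (γ s) (γ t) = |s - t|) ∧ γ 0 = x ∧
        IsBlowup Φ γ (F v) := by
  have hF : ∀ v : V, ∃ w, ‖v‖ = 1 → HasLimDir Φ hX (fun t => Φ.invFun (t • v)) w := fun v => by
    by_cases hv : ‖v‖ = 1
    · obtain ⟨w, hw⟩ := (isBlowup_invFun Φ v).exists_hasLimDir hX hv
      exact ⟨w, fun _ => hw⟩
    · exact ⟨0, fun h => absurd h hv⟩
  choose F hF using hF
  have hF1 : ∀ v, ‖v‖ = 1 → ‖F v‖ = 1 := fun v hv => (hF v hv).norm_eq (isBlowup_invFun Φ v) hv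
  have hle : ∀ v, ‖v‖ = 1 → ∀ v', ‖v'‖ = 1 → inner ℝ v v' ≤ inner ℝ (F v) (F v') := by
    intro v hv v' hv'
    have h1 := (hF v hv).norm_sub_le (isBlowup_invFun Φ v) (isBlowup_invFun Φ v') hv hv' (hF v' hv')
    have h2 := pow_le_pow_left₀ (norm_nonneg _) h1 2
    rw [norm_sub_sq_real, norm_sub_sq_real, hF1 v hv, hF1 v' hv', hv, hv'] at h2
    linarith
  -- The curve given by `exists_neg` has the same first-order limit `-v` as the one defining `F
  -- (-v)`, hence the same limit direction.
  have hneg : ∀ v, ‖v‖ = 1 → F (-v) = -F v := by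
    intro v hv
    have hv' : ‖-v‖ = 1 := by rwa [norm_neg]
    obtain ⟨q, hq, hq'⟩ := (hF v hv).exists_neg hE (isBlowup_invFun Φ v) hv
    have h1 := (hF (-v) hv').norm_sub_le (isBlowup_invFun Φ (-v)) hq hv' hv' hq'
    rw [sub_self, norm_zero] at h1
    exact sub_eq_zero.1 (norm_le_zero_iff.1 h1)
  refine ⟨F, fun v hv v' hv' => le_antisymm ?_ (hle v hv v' hv'),
    fun v hv => (hF v hv).exists_line hE (isBlowup_invFun Φ v) hv⟩
  -- With oddness, the inequality at `-v'` is the reverse inequality at `v'`.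
  have h1 := hle v hv (-v') (by rwa [norm_neg])
  rw [hneg v' hv', inner_neg_right, inner_neg_right] at h1
  linarith

end LimitDirection

/-! ### Complete geodesics through a point in general position -/

section Transversal

/-- An isometric self-map of the unit sphere maps points of the moment curve to vectors such that
no nonzero vector is orthogonal to infinitely many of them. -/
theorem exists_unit_sequence {V : Type*} [NormedAddCommGroup V] [InnerProductSpace ℝ V]
    [FiniteDimensional ℝ V] [Nontrivial V] {F : V → V}
    (hF : ∀ v, ‖v‖ = 1 → ∀ v', ‖v'‖ = 1 → inner ℝ (F v) (F v') = inner ℝ v v') :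
    ∃ v : ℕ → V, (∀ k, ‖v k‖ = 1) ∧ ∀ w, w ≠ 0 → ∀ᶠ k in atTop, inner ℝ w (F (v k)) ≠ 0 := by
  set n := Module.finrank ℝ V
  have hn : 0 < n := Module.finrank_pos
  let e := stdOrthonormalBasis ℝ V
  have he : Orthonormal ℝ (F ∘ e) := by
    rw [orthonormal_iff_ite]
    intro i j
    rw [Function.comp_apply, Function.comp_apply, hF _ (e.orthonormal.1 i) _ (e.orthonormal.1 j)]
    exact orthonormal_iff_ite.1 e.orthonormal i j
  have : Nonempty (Fin n) := ⟨⟨0, hn⟩⟩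
  let f : OrthonormalBasis (Fin n) ℝ V := OrthonormalBasis.mk he
    (he.linearIndependent.span_eq_top_of_card_eq_finrank (by simp [n])).ge
  have hf : ∀ i, f i = F (e i) := fun i => by simp [f]
  let u : ℕ → V := fun k => ∑ i : Fin n, (k : ℝ) ^ (i : ℕ) • e i
  have hu : ∀ k i, inner ℝ (u k) (e i) = (k : ℝ) ^ (i : ℕ) := by
    intro k i
    simp only [u]
    rw [e.orthonormal.inner_left_fintype]
    simp
  have hu0 : ∀ k, u k ≠ 0 := by
    intro k hk
    have := hu k ⟨0, hn⟩
    rw [hk, inner_zero_left] at this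
    simp at this
  refine ⟨fun k => ‖u k‖⁻¹ • u k, fun k => norm_smul_inv_norm (hu0 k), fun w hw => ?_⟩
  -- The values of `F` have in the basis `f = F ∘ e` the coordinates of their arguments in `e`.
  -- Orthogonality to `w` thus says that `k` is a root of `P`, whose coefficients are the
  -- coordinates of `w`.
  let P : Polynomial ℝ := ∑ i : Fin n, Polynomial.C (inner ℝ w (f i)) * Polynomial.X ^ (i : ℕ)
  have hP : P ≠ 0 := by
    intro hP
    refine hw (InnerProductSpace.ext_inner_left_basis f.toBasis fun i => ?_)
    have h1 : P.coeff i = inner ℝ w (f i) := by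
      simp only [P, Polynomial.finsetSum_coeff, Polynomial.coeff_C_mul, Polynomial.coeff_X_pow]
      rw [Finset.sum_eq_single i] <;> simp
      intro j hj h
      exact absurd (Fin.ext h.symm) hj
    rw [hP, Polynomial.coeff_zero] at h1
    rw [f.coe_toBasis, inner_zero_right, real_inner_comm, ← h1]
  have heq : ∀ k : ℕ, inner ℝ w (F (‖u k‖⁻¹ • u k)) = ‖u k‖⁻¹ * P.eval (k : ℝ) := by
    intro k
    rw [← f.sum_inner_mul_inner w, Polynomial.eval_finsetSum, Finset.mul_sum]
    refine Finset.sum_congr rfl fun i _ => ?_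
    have h1 : ‖‖u k‖⁻¹ • u k‖ = 1 := norm_smul_inv_norm (hu0 k)
    rw [hf, hF _ (e.orthonormal.1 i) _ h1, inner_smul_right, real_inner_comm (u k), hu]
    simp only [Polynomial.eval_mul, Polynomial.eval_C, Polynomial.eval_pow, Polynomial.eval_X]
    ring
  have hfin : {k : ℕ | P.eval (k : ℝ) = 0}.Finite := by
    refine Set.Finite.preimage (f := fun k : ℕ => (k : ℝ)) Nat.cast_injective.injOn
      (P.rootSet_finite ℝ) |>.subset fun k hk => ?_
    rw [mem_preimage, Polynomial.mem_rootSet]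
    exact ⟨hP, by simpa using hk⟩
  rw [← Nat.cofinite_eq_atTop]
  filter_upwards [hfin.compl_mem_cofinite] with k hk
  rw [heq]
  exact mul_ne_zero (inv_ne_zero (norm_ne_zero_iff.2 (hu0 k))) hk

/-- Through each point `x` there are complete geodesics such that each point other than `x` is
projected to `x` by finitely many of them only. -/
theorem exists_transversal_sequence {X : Type*} [MetricSpace X] (hX : IsHadamard X)
    (hE : IsInfinitesimallyEuclidean X) (x : X) [Nontrivial X] :
    ∃ γ : ℕ → CompleteGeodesic X, (∀ k, x ∈ range (γ k).toFun) ∧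
      ∀ y, y ≠ x → ∀ᶠ k in atTop, proj (γ k) y ≠ x := by
  have := hX.complete
  have := hX.locallyCompact
  have hC := hX.toIsCAT0
  obtain ⟨V, _, _, _, ⟨Φ⟩⟩ := hE x
  obtain ⟨y₀, hy₀⟩ := exists_ne x
  obtain ⟨w₀, hw₀⟩ := exists_hasDir Φ hC hy₀
  have : Nontrivial V := ⟨w₀, 0, norm_ne_zero_iff.1 (by rw [hw₀.norm_eq hy₀]; exact one_ne_zero)⟩
  obtain ⟨F, hF, hline⟩ := exists_directions Φ hC hE
  obtain ⟨v, hv, hw⟩ := exists_unit_sequence hF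
  choose γ hγ h0 hb using fun k => hline (v k) (hv k)
  refine ⟨fun k => ⟨γ k, 1, one_pos, fun s t => by rw [hγ, one_mul]⟩, fun k => ⟨0, h0 k⟩,
    fun y hy => ?_⟩
  obtain ⟨w, hyw⟩ := exists_hasDir Φ hC hy
  have hw0 : w ≠ 0 := norm_ne_zero_iff.1 (by rw [hyw.norm_eq hy]; exact one_ne_zero)
  filter_upwards [hw w hw0] with k hk hproj
  refine hk (hyw.inner_eq_zero hy (hγ k) (h0 k) (hb k) fun t => ?_)
  have h := (proj_spec hC ⟨γ k, 1, one_pos, fun s t => by rw [hγ, one_mul]⟩ y).2 (γ k t) ⟨t, rfl⟩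
  rwa [hproj] at h

end Transversal

/-! ### Recovery of the atoms and conclusion -/

section Measure
variable {X : Type*} [MetricSpace X] [MeasurableSpace X] [BorelSpace X]

omit [MeasurableSpace X] [BorelSpace X] in
theorem proj_eq_self (hX : IsCAT0 X) (γ : CompleteGeodesic X) {x : X} (hx : x ∈ range γ.toFun) :
    proj γ x = x := by
  have h := (proj_spec hX γ x).2 x hx
  rw [dist_self] at h
  exact (dist_le_zero.1 h).symm

/-- Each `y ≠ x` eventually leaves the fibers over `x`, and `x` always belongs to them; the measure
being finite, pointwise convergence of indicators gives convergence of masses. -/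
theorem tendsto_radon_singleton (hX : IsCAT0 X) {x : X} {γ : ℕ → CompleteGeodesic X}
    (hx : ∀ k, x ∈ range (γ k).toFun) (hγ : ∀ y, y ≠ x → ∀ᶠ k in atTop, proj (γ k) y ≠ x)
    (μ : W₂ X) :
    Tendsto (fun k => radon μ (γ k) {x}) atTop (𝓝 (μ.toMeasure {x})) := by
  have := μ.isProbability
  have hmeas : ∀ k, Measurable (proj (γ k)) := fun k => (continuous_proj hX (γ k)).measurable
  have h : ∀ k, radon μ (γ k) {x} = μ.toMeasure (proj (γ k) ⁻¹' {x}) := fun k =>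
    Measure.map_apply (hmeas k) (measurableSet_singleton x)
  simp_rw [h]
  refine tendsto_measure_of_tendsto_indicator_of_isFiniteMeasure atTop μ.toMeasure
    (fun k => hmeas k (measurableSet_singleton x)) fun y => ?_
  rcases eq_or_ne y x with rfl | hy
  · exact Eventually.of_forall fun k => by simp [proj_eq_self hX (γ k) (hx k)]
  · filter_upwards [hγ y hy] with k hk
    simp [hk, hy]

theorem toMeasure_singleton_eq (hX : IsHadamard X) (hE : IsInfinitesimallyEuclidean X)
    {μ ν : W₂ X} (h : radon μ = radon ν) (x : X) : μ.toMeasure {x} = ν.toMeasure {x} := by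
  -- A one-point space has no complete geodesic, so the transform says nothing, but it carries only
  -- one probability measure.
  rcases subsingleton_or_nontrivial X with hs | hs
  · have := μ.isProbability
    have := ν.isProbability
    have hu : ({x} : Set X) = univ := Set.eq_univ_of_forall fun y => Subsingleton.elim y x
    rw [hu, measure_univ, measure_univ]
  · obtain ⟨γ, hx, hγ⟩ := exists_transversal_sequence hX hE x
    have h1 := tendsto_radon_singleton hX.toIsCAT0 hx hγ μ
    rw [h] at h1
    exact tendsto_nhds_unique h1 (tendsto_radon_singleton hX.toIsCAT0 hx hγ ν)

omit [MetricSpace X] [BorelSpace X] in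
/-- A probability measure with the same atoms as a finitely supported one is equal to it. -/
theorem measure_eq_of_singleton_eq [MeasurableSingletonClass X] {μ ν : Measure X}
    [IsProbabilityMeasure μ] [IsProbabilityMeasure ν] {S : Set X} (hS : S.Finite) (hν : ν Sᶜ = 0)
    (h : ∀ x, μ {x} = ν {x}) : μ = ν := by
  have hfin : ∀ T : Set X, T.Finite → μ T = ν T := by
    intro T hT
    have hT' := hT.coe_toFinset
    rw [← hT', ← sum_measure_singleton, ← sum_measure_singleton]
    exact Finset.sum_congr rfl fun x _ => h x
  -- The atoms in `S` already account for total mass `1`.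
  have hμ : μ Sᶜ = 0 := by
    rw [prob_compl_eq_zero_iff hS.measurableSet, hfin S hS]
    exact (prob_compl_eq_zero_iff hS.measurableSet).1 hν
  ext A -
  rw [← measure_inter_add_sdiff₀ A hS.measurableSet.nullMeasurableSet,
    ← measure_inter_add_sdiff₀ (μ := ν) A hS.measurableSet.nullMeasurableSet,
    hfin _ (hS.subset inter_subset_right),
    measure_mono_null (show A \ S ⊆ Sᶜ from fun _ hx => hx.2) hμ,
    measure_mono_null (show A \ S ⊆ Sᶜ from fun _ hx => hx.2) hν]

end Measure

end PerpRadon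

theorem mainTheorem7 (n : ℕ) {X : Type*} [MetricSpace X] [MeasurableSpace X] [BorelSpace X]
    [ChartedSpace (EuclideanSpace ℝ (Fin n)) X] [IsManifold (𝓡 n) ∞ X]
    [RiemannianBundle (fun x : X => TangentSpace (𝓡 n) x)]
    [IsContMDiffRiemannianBundle (𝓡 n) ∞ (EuclideanSpace ℝ (Fin n))
      (fun x : X => TangentSpace (𝓡 n) x)]
    [IsRiemannianManifold (𝓡 n) X]
    (hX : PerpRadon.IsHadamard X)
    (μ ν : PerpRadon.W₂ X) (hν : PerpRadon.IsFinitelySupported ν)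
    (h : PerpRadon.radon μ = PerpRadon.radon ν) :
    μ = ν := by
  have hE : PerpRadon.IsInfinitesimallyEuclidean X := fun x => PerpRadon.exists_infinitesimalChart n x
  have hatom := PerpRadon.toMeasure_singleton_eq hX hE h
  obtain ⟨S, hS, hνS⟩ := hν
  have := μ.isProbability
  have := ν.isProbability
  have hμν := PerpRadon.measure_eq_of_singleton_eq hS hνS hatom
  cases μ
  cases ν
  simpa using hμν
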